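/- Let $G$ be a finite simple undirected graph in which every edge $uv$ carries two arrival functions $A_{uv}, A_{vu}\colon [0,\infty]\to[0,\infty]$, one for each direction. Each arrival function $A$ is continuous, piecewise linear with finitely many pieces (or the constant $\infty$, meaning that this direction cannot be traversed), satisfies $A(t)\ge t$, and is nondecreasing (FIFO). The arrival function of a path is the composition of the arrival functions of its edges in order of travel (the identity for the path without edges), and for vertices $s,d$ the end-to-end arrival function $A_{(s,d)}(t)$ is the minimum of $A_P(t)$ over all $s$-to-$d$ paths $P$ ($\infty$ if there is none). A breakpoint of a piecewise-linear function $f$ is a real $t>0$ for which there is $\alpha>0$ such that $f'(t-\varepsilon)\neq f'(t+\varepsilon)$ for all $0<\varepsilon<\alpha$; the number of linear pieces of an edge arrival function is its number of breakpoints plus one ($0$ for the constant $\infty$). Theorem. There is an absolute constant $C>0$ such that, for all natural numbers $n,w,K$, if $G$ has at most $n$ vertices, treewidth at most $w$, and at most $K$ linear pieces in total among all its edge arrival functions, then for all vertices $s,d$ of $G$ the function $A_{(s,d)}$ is piecewise linear (or constantly $\infty$) and has at most $$K\, n^{C(\log w)^2}$$ breakpoints, where $(\log w)^2$ is read as $0$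 for $w=0$. That is, the maximum number $b_w(n)$ of breakpoints in an end-to-end arrival function of such a graph is $K n^{O(\log^2 w)}$. -/

import Mathlib

open scoped ENNReal NNReal

/-- A (finite) tree decomposition of the graph `G`. -/
structure TreeDecomposition {V : Type*} (G : SimpleGraph V) where
  /-- The nodes of the tree. -/
  Node : Type
  [fintypeNode : Fintype Node]
  /-- The tree. -/
  tree : SimpleGraph Node
  isTree : tree.IsTree
  /-- The bags. -/
  bag : Node → Set V
  /-- The bags cover all vertices. -/
  cover : ∀ v : V, ∃ i, v ∈ bag i
  /-- Every edge has both ends in some bag. -/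
  edge_cover : ∀ u v : V, G.Adj u v → ∃ i, u ∈ bag i ∧ v ∈ bag i
  /-- If `i`, `j`, `k` lie in this order on a path of the tree, then the bag of `j` contains the
  intersection of the bags of `i` and `k`. -/
  path_inter : ∀ (i j k : Node) (p : tree.Path i k), j ∈ p.1.support → bag i ∩ bag k ⊆ bag j

attribute [instance] TreeDecomposition.fintypeNode

/-- The width: the maximum cardinality of a bag, minus one. -/
noncomputable def TreeDecomposition.width {V : Type*} {G : SimpleGraph V}
    (D : TreeDecomposition G) : ℕ :=
  (Finset.univ.sup fun i : D.Node => (D.bag i).ncard) - 1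

/-- The treewidth of a (finite) graph: the minimum width of a tree decomposition. The set below is
never empty for a finite graph, since all vertices can be put in one bag. -/
noncomputable def treewidth {V : Type*} (G : SimpleGraph V) : ℕ :=
  sInf {k : ℕ | ∃ D : TreeDecomposition G, D.width = k}

/-- Piecewise linearity, with finitely many pieces, of a function `[0, ∞] → [0, ∞]`: either it is
the constant `∞`, or it is finite at all finite times and is affine on each open interval that
contains none of finitely many cut points. (A function that is `∞` on part of `[0, ∞)` only
would not be continuous.) -/
def IsPiecewiseLinear (f : ℝ≥0∞ → ℝ≥0∞) : Prop :=
  (∀ t, f t = ∞) ∨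
    ((∀ t : ℝ≥0, f t ≠ ∞) ∧
      ∃ S : Finset ℝ≥0, ∀ a b : ℝ≥0, (∀ x ∈ S, x ∉ Set.Ioo a b) →
        ∃ m c : ℝ, ∀ t ∈ Set.Ioo a b, (f t).toReal = m * t + c)

/-- The conditions on an edge arrival function: continuous, piecewise linear, never arriving
before departure, and FIFO (a later departure cannot give an earlier arrival). -/
structure IsArrivalFunction (f : ℝ≥0∞ → ℝ≥0∞) : Prop where
  continuous : Continuous f
  piecewiseLinear : IsPiecewiseLinear f
  le_arrival : ∀ t, t ≤ f t
  fifo : Monotone f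

/-- The breakpoints of a piecewise-linear function `f` on `[0, ∞]`: the real times `t > 0` such
that, for all small `ε > 0`, the derivatives of `f` at `t - ε` and at `t + ε` differ.
The constant function `∞` has no breakpoints. -/
def breakpoints (f : ℝ≥0∞ → ℝ≥0∞) : Set ℝ :=
  {t : ℝ | 0 < t ∧ ∃ α : ℝ, 0 < α ∧ ∀ ε : ℝ, 0 < ε → ε < α →
    deriv (fun x : ℝ => (f (ENNReal.ofReal x)).toReal) (t - ε) ≠
      deriv (fun x : ℝ => (f (ENNReal.ofReal x)).toReal) (t + ε)}

open Classical in
/-- The number of linear pieces of a continuous piecewise-linear function: one more than the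
number of breakpoints; the constant function `∞` has no linear piece. -/
noncomputable def numPieces (f : ℝ≥0∞ → ℝ≥0∞) : ℕ :=
  if ∀ t, f t = ∞ then 0 else (breakpoints f).ncard + 1

/-- A time-dependent graph: a simple undirected graph in which each edge `uv` carries an arrival
function for each of its two directions (darts). A direction that cannot be traversed carries the
constant function `∞`. -/
structure TimeDependentGraph (V : Type*) where
  /-- The underlying graph. -/
  graph : SimpleGraph V
  /-- The arrival function of a directed edge. -/
  arrival : graph.Dart → ℝ≥0∞ → ℝ≥0∞
  isArrivalFunction : ∀ e, IsArrivalFunction (arrival e)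

namespace TimeDependentGraph

variable {V : Type*} (G : TimeDependentGraph V)

/-- The arrival function of a walk: the composition of the arrival functions of its edges. -/
def walkArrival : {u v : V} → G.graph.Walk u v → ℝ≥0∞ → ℝ≥0∞
  | _, _, .nil => id
  | _, _, .cons h p => walkArrival p ∘ G.arrival ⟨(_, _), h⟩

/-- The end-to-end arrival function from `s` to `d`: the minimum of the arrival functions of all
paths from `s` to `d` (`∞` if there is no path). -/
noncomputable def endToEnd (s d : V) (t : ℝ≥0∞) : ℝ≥0∞ :=
  ⨅ p : G.graph.Path s d, G.walkArrival p.1 t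

open Classical in
/-- The total number of linear pieces among all edge arrival functions (both directions). -/
noncomputable def totalPieces [Fintype V] : ℕ :=
  ∑ e : G.graph.Dart, numPieces (G.arrival e)

end TimeDependentGraph

/-!
Why the bound holds.

*Linear pieces of edges.* Fix `s` and `d`. For every breakpoint `β` of an edge with tail `u`, mark
the departure time from `s` from which on `u` cannot be reached before `β`. While the departure time
does not cross a mark, every edge acts as a single line on the earliest arrivals at its tail
(`TimeDependentGraph.IsUsable.exists_monoLine`). All edges may then be replaced by these
nondecreasing lines: no route gets earlier than the earliest arrival, and a path of tight steps
attains it. Hence between two marks the end-to-end function is a lower envelope of lines of routes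
(`TimeDependentGraph.exists_isEnvelopeOn_gap`), and if `p` lines suffice to cover all paths, it has
at most `p - 1` breakpoints there. There are fewer than `K` marks, which gives at most `K * p`
breakpoints (`TimeDependentGraph.breakpoints_endToEnd_le`).

*Counting lines.* The relation `MonoLine.Covered` says that a set of lines is bounded below by
few lines. It is subadditive under unions and, by `MonoLine.exists_comp_envelope`, also under
compositions. A bag `S` of a tree decomposition of width `w` cuts a vertex set `C` into classes of
at most half its size (`TreeDecomposition.exists_separator`). A path inside `C` meets `S` at most
`w + 1` times, so it is a concatenation of pieces inside classes, and halving the number of visits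
to `S` about `log w` times multiplies the number of lines by `(2 * w + 3) ^ O(log w)`. The recursion
over separators has depth about `log n`, and the sizes of the classes add up to at most the size
of `C`, so `p = w ^ O(log w * log n) = n ^ O((log w) ^ 2)` lines suffice
(`MonoLine.covered_paths`).

For `w ≤ 1` the exponent of the bound is `0`. Then the graph is a forest
(`TreeDecomposition.isAcyclic_of_width_le_one`), there is at most one path, and `p = 1`.
-/

/-! ### Lower envelopes of nondecreasing lines -/

/-- A nondecreasing affine function `t ↦ slope * t + icpt` on the real line. -/
structure MonoLine where
  /-- The slope. -/
  slope : ℝ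
  /-- The value at `0`. -/
  icpt : ℝ
  slope_nonneg : 0 ≤ slope

namespace MonoLine

/-- The value of the line at `t`. -/
def eval (ℓ : MonoLine) (t : ℝ) : ℝ := ℓ.slope * t + ℓ.icpt

lemma eval_mono (ℓ : MonoLine) : Monotone ℓ.eval := fun _ _ h => by
  have := mul_le_mul_of_nonneg_left h ℓ.slope_nonneg
  unfold eval
  linarith

/-- The composition `t ↦ g (f t)` of two lines. -/
def comp (g f : MonoLine) : MonoLine where
  slope := g.slope * f.slope
  icpt := g.slope * f.icpt + g.icpt
  slope_nonneg := mul_nonneg g.slope_nonneg f.slope_nonneg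

@[simp] lemma eval_comp (g f : MonoLine) (t : ℝ) : (g.comp f).eval t = g.eval (f.eval t) := by
  simp only [eval, comp]
  ring

lemma comp_assoc (h g f : MonoLine) : (h.comp g).comp f = h.comp (g.comp f) := by
  simp only [comp, MonoLine.mk.injEq]
  constructor <;> ring

/-- A steeper line stays below a flatter one to the left of a point where it is below it. -/
lemma eval_le_of_slope_le {f g : MonoLine} (h : g.slope ≤ f.slope) {t t' : ℝ} (ht : t ≤ t')
    (hle : f.eval t' ≤ g.eval t') : f.eval t ≤ g.eval t := by
  unfold eval at *
  nlinarith [mul_nonneg (sub_nonneg.2 h) (sub_nonneg.2 ht)]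

open Classical in
/-- The lower envelope of the compositions of two lower envelopes of nondecreasing lines, with
`p` and `q` lines, needs only `p + q - 1` of the compositions: as time increases, the active pair
of lines runs through a monotone staircase. The induction peels off the pair of steepest
lines `f₁`, `g₁`, and then one of these two lines. -/
lemma exists_comp_envelope (F G : Finset MonoLine) (hF : F.Nonempty) (hG : G.Nonempty) :
    ∃ H : Finset MonoLine, H.card + 1 ≤ F.card + G.card ∧
      (∀ h ∈ H, ∃ f ∈ F, ∃ g ∈ G, h = g.comp f) ∧
      ∀ t, ∀ f ∈ F, ∀ g ∈ G, ∃ h ∈ H, h.eval t ≤ g.eval (f.eval t) := by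
  induction hn : F.card + G.card generalizing F G with
  | zero => have := hF.card_pos; omega
  | succ n ih =>
    obtain ⟨f₁, hf₁, hf₁max⟩ := F.exists_max_image MonoLine.slope hF
    obtain ⟨g₁, hg₁, hg₁max⟩ := G.exists_max_image MonoLine.slope hG
    have hcF := Finset.card_erase_add_one hf₁
    have hcG := Finset.card_erase_add_one hg₁
    rcases (F.erase f₁).eq_empty_or_nonempty with hF' | hF'
    · refine ⟨G.image (fun g => g.comp f₁), ?_, ?_, ?_⟩
      · have := Finset.card_image_le (s := G) (f := fun g => g.comp f₁)
        rw [hF'] at hcF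
        simp at hcF
        omega
      · simp only [Finset.mem_image]
        rintro h ⟨g, hg, rfl⟩
        exact ⟨f₁, hf₁, g, hg, rfl⟩
      · intro t f hf g hg
        have : f = f₁ := by
          by_contra hne
          have := Finset.mem_erase.2 ⟨hne, hf⟩
          simp [hF'] at this
        subst this
        exact ⟨g.comp f, Finset.mem_image_of_mem _ hg, by simp⟩
    rcases (G.erase g₁).eq_empty_or_nonempty with hG' | hG'
    · refine ⟨F.image (fun f => g₁.comp f), ?_, ?_, ?_⟩
      · have := Finset.card_image_le (s := F) (f := fun f => g₁.comp f)
        rw [hG'] at hcG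
        simp at hcG
        omega
      · simp only [Finset.mem_image]
        rintro h ⟨f, hf, rfl⟩
        exact ⟨f, hf, g₁, hg₁, rfl⟩
      · intro t f hf g hg
        have : g = g₁ := by
          by_contra hne
          have := Finset.mem_erase.2 ⟨hne, hg⟩
          simp [hG'] at this
        subst this
        exact ⟨g.comp f, Finset.mem_image_of_mem _ hf, by simp⟩
    by_cases hcase : ∀ t, (∀ f ∈ F.erase f₁, f₁.eval t ≤ f.eval t) →
        ∀ g ∈ G.erase g₁, g₁.eval (f₁.eval t) ≤ g.eval (f₁.eval t)
    · obtain ⟨H, hHc, hHsub, hH⟩ := ih (F.erase f₁) G hF' hG (by omega)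
      refine ⟨insert (g₁.comp f₁) H, ?_, ?_, ?_⟩
      · have := Finset.card_insert_le (g₁.comp f₁) H
        omega
      · intro h hh
        rcases Finset.mem_insert.1 hh with rfl | hh
        · exact ⟨f₁, hf₁, g₁, hg₁, rfl⟩
        · obtain ⟨f, hf, g, hg, rfl⟩ := hHsub h hh
          exact ⟨f, Finset.mem_of_mem_erase hf, g, hg, rfl⟩
      · intro t f hf g hg
        by_cases hA : ∀ f ∈ F.erase f₁, f₁.eval t ≤ f.eval t
        · refine ⟨g₁.comp f₁, Finset.mem_insert_self _ _, ?_⟩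
          rw [eval_comp]
          have h1 : f₁.eval t ≤ f.eval t := by
            by_cases hff : f = f₁
            · rw [hff]
            · exact hA f (Finset.mem_erase.2 ⟨hff, hf⟩)
          have h2 : g₁.eval (f₁.eval t) ≤ g.eval (f₁.eval t) := by
            by_cases hgg : g = g₁
            · rw [hgg]
            · exact hcase t hA g (Finset.mem_erase.2 ⟨hgg, hg⟩)
          exact h2.trans (g.eval_mono h1)
        · push Not at hA
          obtain ⟨f', hf', hlt⟩ := hA
          by_cases hff : f = f₁
          · subst hff
            obtain ⟨h, hh, hle⟩ := hH t f' hf' g hg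
            exact ⟨h, Finset.mem_insert_of_mem hh, hle.trans (g.eval_mono hlt.le)⟩
          · obtain ⟨h, hh, hle⟩ := hH t f (Finset.mem_erase.2 ⟨hff, hf⟩) g hg
            exact ⟨h, Finset.mem_insert_of_mem hh, hle⟩
    · push Not at hcase
      obtain ⟨t₀, ht₀, g₀, hg₀, hlt₀⟩ := hcase
      obtain ⟨H, hHc, hHsub, hH⟩ := ih F (G.erase g₁) hF hG' (by omega)
      refine ⟨insert (g₁.comp f₁) H, ?_, ?_, ?_⟩
      · have := Finset.card_insert_le (g₁.comp f₁) H
        omega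
      · intro h hh
        rcases Finset.mem_insert.1 hh with rfl | hh
        · exact ⟨f₁, hf₁, g₁, hg₁, rfl⟩
        · obtain ⟨f, hf, g, hg, rfl⟩ := hHsub h hh
          exact ⟨f, hf, g, Finset.mem_of_mem_erase hg, rfl⟩
      · intro t f hf g hg
        by_cases hgg : g = g₁
        swap
        · obtain ⟨h, hh, hle⟩ := hH t f hf g (Finset.mem_erase.2 ⟨hgg, hg⟩)
          exact ⟨h, Finset.mem_insert_of_mem hh, hle⟩
        subst hgg
        by_cases hX : g.eval (f.eval t) ≤ g₀.eval (f.eval t)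
        · refine ⟨g.comp f₁, Finset.mem_insert_self _ _, ?_⟩
          rw [eval_comp]
          refine g.eval_mono ?_
          by_cases hff : f = f₁
          · rw [hff]
          by_contra hnot
          -- `t` lies to the right of `t₀`, hence `f t` lies to the right of `f₁ t₀`
          have htt : t₀ ≤ t := by
            by_contra hlt
            exact hnot (eval_le_of_slope_le (hf₁max f hf) (not_le.1 hlt).le
              (ht₀ f (Finset.mem_erase.2 ⟨hff, hf⟩)))
          have h1 : f₁.eval t₀ ≤ f.eval t :=
            (ht₀ f (Finset.mem_erase.2 ⟨hff, hf⟩)).trans (f.eval_mono htt)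
          exact not_le.2 hlt₀
            (eval_le_of_slope_le (hg₁max g₀ (Finset.mem_of_mem_erase hg₀)) h1 hX)
        · obtain ⟨h, hh, hle⟩ := hH t f hf g₀ hg₀
          exact ⟨h, Finset.mem_insert_of_mem hh, hle.trans (not_le.1 hX).le⟩

/-- `Covered X Z p`: at most `p` lines of `Z` suffice to bound the lines of `X` from below
pointwise. Then every function squeezed between the lower envelopes of `Z` and of `X` is a minimum
of at most `p` lines. -/
def Covered (X Z : Set MonoLine) (p : ℕ) : Prop :=
  ∃ F : Finset MonoLine, ↑F ⊆ Z ∧ F.card ≤ p ∧ ∀ ℓ ∈ X, ∀ t, ∃ m ∈ F, m.eval t ≤ ℓ.eval t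

lemma Covered.mono {X X' Z Z' : Set MonoLine} {p p' : ℕ} (h : Covered X Z p) (hX : X' ⊆ X)
    (hZ : Z ⊆ Z') (hp : p ≤ p') : Covered X' Z' p' := by
  obtain ⟨F, h1, h2, h3⟩ := h
  exact ⟨F, h1.trans hZ, h2.trans hp, fun ℓ hℓ => h3 ℓ (hX hℓ)⟩

lemma Covered.of_subsingleton {X Z : Set MonoLine} (h : X.Subsingleton) (hXZ : X ⊆ Z) :
    Covered X Z 1 := by
  rcases h.eq_empty_or_singleton with rfl | ⟨ℓ, rfl⟩
  · exact ⟨∅, by simp, by simp, by simp⟩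
  · refine ⟨{ℓ}, by simpa using hXZ, by simp, ?_⟩
    rintro _ rfl t
    exact ⟨_, by simp, le_rfl⟩

open Classical in
lemma Covered.union {X Y Z : Set MonoLine} {p q : ℕ} (hX : Covered X Z p) (hY : Covered Y Z q) :
    Covered (X ∪ Y) Z (p + q) := by
  obtain ⟨F, h1, h2, h3⟩ := hX
  obtain ⟨G, k1, k2, k3⟩ := hY
  refine ⟨F ∪ G, by simp [h1, k1], (Finset.card_union_le _ _).trans (by omega), ?_⟩
  rintro ℓ (hℓ | hℓ) t
  · obtain ⟨m, hm, hle⟩ := h3 ℓ hℓ t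
    exact ⟨m, Finset.mem_union_left _ hm, hle⟩
  · obtain ⟨m, hm, hle⟩ := k3 ℓ hℓ t
    exact ⟨m, Finset.mem_union_right _ hm, hle⟩

open Classical in
lemma Covered.biUnion {ι : Type*} {I : Finset ι} {X : ι → Set MonoLine} {Z : Set MonoLine}
    {p : ι → ℕ} (h : ∀ i ∈ I, Covered (X i) Z (p i)) :
    Covered (⋃ i ∈ I, X i) Z (∑ i ∈ I, p i) := by
  induction I using Finset.induction_on with
  | empty => exact ⟨∅, by simp, by simp, by simp⟩
  | insert a I ha ih =>
    rw [Finset.sum_insert ha, Finset.set_biUnion_insert]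
    exact (h a (Finset.mem_insert_self _ _)).union
      (ih fun i hi => h i (Finset.mem_insert_of_mem hi))

lemma Covered.comp {X Y Z Z' : Set MonoLine} {p q : ℕ} (hX : Covered X Z p)
    (hY : Covered Y Z' q) :
    Covered (Set.image2 MonoLine.comp Y X) (Set.image2 MonoLine.comp Z' Z) (p + q) := by
  obtain ⟨F, h1, h2, h3⟩ := hX
  obtain ⟨G, k1, k2, k3⟩ := hY
  by_cases hne : F.Nonempty ∧ G.Nonempty
  · obtain ⟨H, hc, hsub, hH⟩ := exists_comp_envelope F G hne.1 hne.2
    refine ⟨H, ?_, by omega, ?_⟩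
    · intro h hh
      obtain ⟨f, hf, g, hg, rfl⟩ := hsub h hh
      exact ⟨g, k1 hg, f, h1 hf, rfl⟩
    · rintro _ ⟨y, hy, x, hx, rfl⟩ t
      obtain ⟨f, hf, hle⟩ := h3 x hx t
      obtain ⟨g, hg, hle'⟩ := k3 y hy (x.eval t)
      obtain ⟨h, hh, hle''⟩ := hH t f hf g hg
      rw [eval_comp]
      exact ⟨h, hh, hle''.trans ((g.eval_mono hle).trans hle')⟩
  · refine ⟨∅, by simp, by simp, ?_⟩
    rintro _ ⟨y, hy, x, hx, rfl⟩ t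
    obtain ⟨f, hf, -⟩ := h3 x hx t
    obtain ⟨g, hg, -⟩ := k3 y hy t
    exact absurd ⟨⟨f, hf⟩, ⟨g, hg⟩⟩ hne

end MonoLine

/-! ### Balanced separators and forests from tree decompositions -/

namespace SimpleGraph

variable {N : Type*} {T : SimpleGraph N}

/-- In a forest, every walk between two nodes runs through all nodes of the path between them. -/
lemma IsAcyclic.mem_support_of_path (hT : T.IsAcyclic) {i j x : N} (p : T.Path i j)
    (hx : x ∈ p.1.support) (q : T.Walk i j) : x ∈ q.support := by
  classical
  have : p = q.toPath := (hT.subsingleton_path i j).elim p q.toPath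
  rw [this] at hx
  exact q.support_bypass_subset_support hx

end SimpleGraph

namespace TreeDecomposition

variable {V : Type*} {G : SimpleGraph V} (D : TreeDecomposition G)

/-- Two nodes are joined by a walk in the tree that avoids the node `i`. -/
def Avoids (i j k : D.Node) : Prop := ∃ p : D.tree.Walk j k, i ∉ p.support

variable {D}

lemma Avoids.symm {i j k : D.Node} (h : D.Avoids i j k) : D.Avoids i k j := by
  obtain ⟨p, hp⟩ := h
  exact ⟨p.reverse, by simpa using hp⟩

lemma Avoids.trans {i j k l : D.Node} (h : D.Avoids i j k) (h' : D.Avoids i k l) :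
    D.Avoids i j l := by
  obtain ⟨p, hp⟩ := h
  obtain ⟨q, hq⟩ := h'
  exact ⟨p.append q, by simp [SimpleGraph.Walk.mem_support_append_iff, hp, hq]⟩

lemma avoids_of_mem_bag {i j k : D.Node} {v : V} (hi : v ∉ D.bag i) (hj : v ∈ D.bag j)
    (hk : v ∈ D.bag k) : D.Avoids i j k := by
  classical
  obtain ⟨p⟩ := D.isTree.1.preconnected j k
  exact ⟨p.toPath.1, fun hmem => hi (D.path_inter j i k p.toPath hmem ⟨hj, hk⟩)⟩

lemma ncard_bag_le {w : ℕ} (h : D.width ≤ w) (i : D.Node) : (D.bag i).ncard ≤ w + 1 := by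
  have : (D.bag i).ncard ≤ Finset.univ.sup fun i : D.Node => (D.bag i).ncard :=
    Finset.le_sup (f := fun i : D.Node => (D.bag i).ncard) (Finset.mem_univ i)
  unfold width at h
  omega

open Classical in
/-- Some bag of a tree decomposition is a balanced separator for `U`. The components left by the
bag are described by a function `cls` that is constant along the edges outside the bag.

If no bag of a node is balanced, then every node `i` has a heavy branch. For a heavy branch with
the fewest nodes, consider the neighbour `j` of `i` in it: two heavy branches share
a vertex of `U`, so the heavy branch at `j` does not contain `i`, and it is smaller. -/
lemma exists_separator (D : TreeDecomposition G) (U : Finset V) :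
    ∃ i : D.Node, ∃ cls : V → Set D.Node,
      (∀ u v, G.Adj u v → u ∉ D.bag i → v ∉ D.bag i → cls u = cls v) ∧
      ∀ c, 2 * (U.filter fun x => x ∉ D.bag i ∧ cls x = c).card ≤ U.card := by
  choose node hnode using D.cover
  let cls : D.Node → V → Set D.Node := fun i v => {k | D.Avoids i (node v) k}
  have hcls : ∀ i u v, G.Adj u v → u ∉ D.bag i → v ∉ D.bag i → cls i u = cls i v := by
    intro i u v huv hu hv
    obtain ⟨j, hju, hjv⟩ := D.edge_cover u v huv
    have h : D.Avoids i (node u) (node v) :=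
      (avoids_of_mem_bag hu (hnode u) hju).trans (avoids_of_mem_bag hv hjv (hnode v))
    ext k
    exact ⟨fun hk => h.symm.trans hk, fun hk => h.trans hk⟩
  by_contra hcon
  push Not at hcon
  have hbad : ∀ i, ∃ c, U.card < 2 * (U.filter fun x => x ∉ D.bag i ∧ cls i x = c).card :=
    fun i => hcon i (cls i) (hcls i)
  choose c hc using hbad
  have hne : Nonempty D.Node := D.isTree.1.nonempty
  obtain ⟨i, -, hi⟩ := Finset.exists_min_image Finset.univ (fun i => (c i).ncard)
    Finset.univ_nonempty
  have hex : ∀ i, ∃ x ∈ U, x ∉ D.bag i ∧ cls i x = c i := by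
    intro i
    have : 0 < (U.filter fun x => x ∉ D.bag i ∧ cls i x = c i).card := by
      have := hc i
      omega
    obtain ⟨x, hx⟩ := Finset.card_pos.1 this
    exact ⟨x, by simpa using hx⟩
  obtain ⟨x, -, hxi, hxc⟩ := hex i
  have hik : i ≠ node x := fun h => hxi (h ▸ hnode x)
  obtain ⟨p₀⟩ := D.isTree.1.preconnected i (node x)
  -- the neighbour `j` of `i` in its heavy branch
  obtain ⟨j, hij, q, hq⟩ : ∃ j, D.tree.Adj i j ∧ ∃ q : D.tree.Walk j (node x), i ∉ q.support := by
    obtain ⟨p, hp⟩ := p₀.toPath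
    cases p with
    | nil => exact absurd rfl hik
    | cons h q => exact ⟨_, h, q, ((SimpleGraph.Walk.cons_isPath_iff h q).1 hp).2⟩
  have hjc : D.Avoids i (node x) j := Avoids.symm ⟨q, hq⟩
  -- the heavy sets at `i` and at `j` meet
  obtain ⟨v, hv, hvi, hvci, hvj, hvcj⟩ : ∃ v ∈ U, v ∉ D.bag i ∧ cls i v = c i ∧
      v ∉ D.bag j ∧ cls j v = c j := by
    by_contra hno
    push Not at hno
    have hdisj : Disjoint (U.filter fun x => x ∉ D.bag i ∧ cls i x = c i)
        (U.filter fun x => x ∉ D.bag j ∧ cls j x = c j) := by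
      rw [Finset.disjoint_left]
      intro v h1 h2
      simp only [Finset.mem_filter] at h1 h2
      exact hno v h1.1 h1.2.1 h1.2.2 h2.2.1 h2.2.2
    have h1 := Finset.card_union_of_disjoint hdisj
    have h2 : _ ≤ U.card := Finset.card_le_card (Finset.union_subset
      (Finset.filter_subset (fun x => x ∉ D.bag i ∧ cls i x = c i) U)
      (Finset.filter_subset (fun x => x ∉ D.bag j ∧ cls j x = c j) U))
    have := hc i
    have := hc j
    omega
  have hva : D.Avoids i j (node v) := by
    have : node v ∈ cls i x := by
      rw [hxc, ← hvci]
      exact avoids_of_mem_bag hvi (hnode v) (hnode v)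
    exact hjc.symm.trans this
  have hnot : ¬ D.Avoids j (node v) i := by
    rintro ⟨r, hr⟩
    obtain ⟨s, hs⟩ := hva
    have hs' : i ∉ s.toPath.1.support := fun h => hs (s.support_bypass_subset_support h)
    have hpath : (SimpleGraph.Walk.cons hij s.toPath.1).IsPath :=
      (SimpleGraph.Walk.cons_isPath_iff _ _).2 ⟨s.toPath.2, hs'⟩
    have := D.isTree.2.mem_support_of_path ⟨_, hpath⟩ (x := j) (by simp) r.reverse
    exact hr (by simpa using this)
  have hsub : c j ⊂ c i := by
    rw [← hvcj, ← hvci]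
    refine ⟨?_, fun hsup => ?_⟩
    · rintro k ⟨r, hr⟩
      refine ⟨r, fun hir => hnot ⟨r.takeUntil i hir, fun h => hr ?_⟩⟩
      exact r.support_takeUntil_subset_support hir h
    · have : j ∈ cls j v := hsup (hva.symm)
      obtain ⟨r, hr⟩ := this
      exact hr r.end_mem_support
  exact absurd (hi j (Finset.mem_univ j)) (not_le.2 (Set.ncard_lt_ncard hsub (Set.toFinite _)))

/-- Every nonempty set `U` of vertices contains a vertex that shares a bag with all its neighbours
in `U`. With the tree rooted at `r`, let the top of a vertex be the node closest to `r` whose bag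
contains it; a vertex of `U` whose top is farthest from the root has the property. -/
lemma exists_mem_bag_neighbors (D : TreeDecomposition G) (U : Finset V) (hU : U.Nonempty) :
    ∃ v ∈ U, ∃ i, v ∈ D.bag i ∧ ∀ u ∈ U, G.Adj v u → u ∈ D.bag i := by
  classical
  obtain ⟨r⟩ := D.isTree.1.nonempty
  have htop : ∀ v, ∃ i, v ∈ D.bag i ∧ ∀ j, v ∈ D.bag j → D.tree.dist r i ≤ D.tree.dist r j := by
    intro v
    obtain ⟨i₀, hi₀⟩ := D.cover v
    obtain ⟨i, hi, hmin⟩ := Finset.exists_min_image (Finset.univ.filter fun i => v ∈ D.bag i)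
      (D.tree.dist r) ⟨i₀, by simpa using hi₀⟩
    exact ⟨i, by simpa using hi, fun j hj => hmin j (by simpa using hj)⟩
  choose top htop₁ htop₂ using htop
  obtain ⟨v, hv, hmax⟩ := U.exists_max_image (fun v => D.tree.dist r (top v)) hU
  refine ⟨v, hv, top v, htop₁ v, fun u hu huv => ?_⟩
  obtain ⟨j, hjv, hju⟩ := D.edge_cover v u huv
  by_contra hcon
  have hgeo : ∀ k x, ∀ p : D.tree.Walk r k, p.length = D.tree.dist r k → x ∈ p.support → x ≠ k →
      D.tree.dist r x < D.tree.dist r k := by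
    intro k x p hp hx hxk
    calc D.tree.dist r x ≤ (p.takeUntil x hx).length := SimpleGraph.dist_le _
      _ < p.length := SimpleGraph.Walk.length_takeUntil_lt_length hx hxk
      _ = _ := hp
  have hrk : D.Avoids (top v) r (top u) := by
    obtain ⟨p, hp⟩ := D.isTree.1.exists_walk_length_eq_dist r (top u)
    refine ⟨p, fun hmem => ?_⟩
    have hne : top v ≠ top u := fun h => hcon (h ▸ htop₁ u)
    exact absurd (hgeo _ _ p hp hmem hne) (not_lt.2 (hmax u hu))
  have hrj : D.Avoids (top v) r j := hrk.trans (avoids_of_mem_bag hcon (htop₁ u) hju)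
  have hij : top v ≠ j := fun h => hcon (h ▸ hju)
  obtain ⟨s₀⟩ := D.isTree.1.preconnected (top v) j
  obtain ⟨j', hadj, hj'v, havoid⟩ : ∃ j', D.tree.Adj (top v) j' ∧ v ∈ D.bag j' ∧
      D.Avoids (top v) j' j := by
    have hin : ∀ x ∈ s₀.toPath.1.support, v ∈ D.bag x := fun x hx =>
      D.path_inter _ _ _ s₀.toPath hx ⟨htop₁ v, hjv⟩
    generalize s₀.toPath = s' at hin
    obtain ⟨s, hs⟩ := s'
    cases s with
    | nil => exact absurd rfl hij
    | @cons _ x _ h q => exact ⟨x, h, hin x (by simp), q,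
        ((SimpleGraph.Walk.cons_isPath_iff h q).1 hs).2⟩
  obtain ⟨m, hm⟩ := hrj.trans havoid.symm
  obtain ⟨p, hp⟩ := D.isTree.1.exists_walk_length_eq_dist r (top v)
  have hnot : j' ∉ p.support := fun hmem =>
    absurd (hgeo _ _ p hp hmem hadj.ne') (not_lt.2 (htop₂ v j' hj'v))
  have hpath : (p.concat hadj).IsPath := (p.isPath_of_length_eq_dist hp).concat hnot hadj
  exact hm (D.isTree.2.mem_support_of_path ⟨_, hpath⟩ (x := top v)
    (by simp [SimpleGraph.Walk.support_concat]) m)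

/-- A graph with a tree decomposition of width at most one is a forest: a vertex of a cycle that
shares a bag with its two neighbours on the cycle would need a bag of three vertices. -/
lemma isAcyclic_of_width_le_one [Finite V] (D : TreeDecomposition G) (h : D.width ≤ 1) :
    G.IsAcyclic := by
  classical
  intro a p hp
  obtain ⟨v, hv, i, hvi, hnb⟩ := D.exists_mem_bag_neighbors p.support.toFinset ⟨a, by simp⟩
  have hv' : v ∈ p.support := by simpa using hv
  have h2 := hp.ncard_neighborSet_toSubgraph_eq_two hv'
  have hsub : insert v (p.toSubgraph.neighborSet v) ⊆ D.bag i := by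
    rintro x (rfl | hx)
    · exact hvi
    · have hadj : p.toSubgraph.Adj v x := hx
      exact hnb x (by simpa using hadj.snd_mem) hadj.adj_sub
  have h3 := Set.ncard_le_ncard hsub (Set.toFinite _)
  have h4 : (insert v (p.toSubgraph.neighborSet v)).ncard = (p.toSubgraph.neighborSet v).ncard + 1 :=
    Set.ncard_insert_of_notMem (fun hx => (show p.toSubgraph.Adj v v from hx).ne rfl)
      (Set.toFinite _)
  have := ncard_bag_le h i
  omega

end TreeDecomposition

/-! ### Covering the paths of a graph of bounded treewidth -/

namespace MonoLine

section Routes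

variable {V : Type*} (l : V → V → MonoLine) (R : V → V → Prop)

/-- A route from `u` to `v` with at least one step, given by the list of its interior vertices:
consecutive vertices are related by `R`. -/
def IsRoute : V → List V → V → Prop
  | u, [], v => R u v
  | u, x :: L, v => R u x ∧ IsRoute x L v

/-- The composition of the lines `l` along the steps of a route. -/
def routeLine : V → List V → V → MonoLine
  | u, [], v => l u v
  | u, x :: L, v => (routeLine x L v).comp (l u x)

/-- The lines of all routes from `u` to `v` with a list of interior vertices that satisfies `P`. -/
def routeLines (P : List V → Prop) (u v : V) : Set MonoLine :=
  {ℓ | ∃ L, IsRoute R u L v ∧ P L ∧ routeLine l u L v = ℓ}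

variable {l R}

lemma isRoute_append {u x v : V} {L₁ L₂ : List V} :
    IsRoute R u (L₁ ++ x :: L₂) v ↔ IsRoute R u L₁ x ∧ IsRoute R x L₂ v := by
  induction L₁ generalizing u with
  | nil => rfl
  | cons a L₁ ih => simp only [List.cons_append, IsRoute, ih, and_assoc]

lemma routeLine_append {u x v : V} {L₁ L₂ : List V} :
    routeLine l u (L₁ ++ x :: L₂) v = (routeLine l x L₂ v).comp (routeLine l u L₁ x) := by
  induction L₁ generalizing u with
  | nil => rfl
  | cons a L₁ ih => simp only [List.cons_append, routeLine, ih, comp_assoc]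

lemma routeLines_mono {P Q : List V → Prop} (h : ∀ L, P L → Q L) (u v : V) :
    routeLines l R P u v ⊆ routeLines l R Q u v := by
  rintro ℓ ⟨L, h1, h2, h3⟩
  exact ⟨L, h1, h L h2, h3⟩

lemma image2_comp_routeLines_subset (u x v : V) :
    Set.image2 comp (routeLines l R (fun _ => True) x v) (routeLines l R (fun _ => True) u x) ⊆
      routeLines l R (fun _ => True) u v := by
  rintro _ ⟨_, ⟨L₂, h2, -, rfl⟩, _, ⟨L₁, h1, -, rfl⟩, rfl⟩
  exact ⟨L₁ ++ x :: L₂, isRoute_append.2 ⟨h1, h2⟩, trivial, routeLine_append⟩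

lemma _root_.List.exists_append_cons_countP_eq {α : Type*} (p : α → Bool) (L : List α) (a : ℕ)
    (h : a < L.countP p) : ∃ L₁ x L₂, L = L₁ ++ x :: L₂ ∧ p x ∧ L₁.countP p = a := by
  induction L generalizing a with
  | nil => simp at h
  | cons y L ih =>
    by_cases hy : p y
    · cases a with
      | zero => exact ⟨[], y, L, rfl, hy, rfl⟩
      | succ a =>
        rw [List.countP_cons_of_pos hy] at h
        obtain ⟨L₁, x, L₂, rfl, hx, hc⟩ := ih a (by omega)
        exact ⟨y :: L₁, x, L₂, rfl, hx, by rw [List.countP_cons_of_pos hy, hc]⟩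
    · rw [List.countP_cons_of_neg hy] at h
      obtain ⟨L₁, x, L₂, rfl, hx, hc⟩ := ih a h
      exact ⟨y :: L₁, x, L₂, rfl, hx, by rw [List.countP_cons_of_neg hy, hc]⟩

open Classical in
/-- Routes with fewer than `2 ^ j` interior vertices in `S` are obtained from those with none
by `j` doublings: a route either has less than half of the allowed visits to `S`, or splits at a
visit into two routes that do. -/
lemma covered_of_countP_lt {P : List V → Prop} (hP : ∀ L₁ x L₂, P (L₁ ++ x :: L₂) → P L₁ ∧ P L₂)
    (S : Finset V) (p : ℕ)
    (h₀ : ∀ u v, Covered (routeLines l R (fun L => P L ∧ L.countP (· ∈ S) = 0) u v)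
      (routeLines l R (fun _ => True) u v) p) (j : ℕ) (u v : V) :
    Covered (routeLines l R (fun L => P L ∧ L.countP (· ∈ S) < 2 ^ j) u v)
      (routeLines l R (fun _ => True) u v) ((2 * S.card + 1) ^ j * p) := by
  induction j generalizing u v with
  | zero =>
    refine (h₀ u v).mono (routeLines_mono (fun L hL => ⟨hL.1, ?_⟩) u v) subset_rfl (by simp)
    have := hL.2
    simpa using this
  | succ j ih =>
    set q := (2 * S.card + 1) ^ j * p with hq
    have key := (ih u v).union (Covered.biUnion (I := S) (fun x _ =>
      ((ih u x).comp (ih x v)).mono subset_rfl (image2_comp_routeLines_subset u x v) le_rfl))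
    refine key.mono ?_ subset_rfl ?_
    · rintro _ ⟨L, hL, ⟨hLP, hLc⟩, rfl⟩
      by_cases hlt : L.countP (· ∈ S) < 2 ^ j
      · exact Or.inl ⟨L, hL, ⟨hLP, hlt⟩, rfl⟩
      · have hpos : 0 < 2 ^ j := by positivity
        obtain ⟨L₁, x, L₂, rfl, hx, hc⟩ :=
          List.exists_append_cons_countP_eq (· ∈ S) L (2 ^ j - 1) (by omega)
        have hx' : x ∈ S := by simpa using hx
        obtain ⟨h1, h2⟩ := isRoute_append.1 hL
        obtain ⟨hP1, hP2⟩ := hP _ _ _ hLP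
        refine Or.inr (Set.mem_iUnion₂.2 ⟨x, hx', _, ⟨L₂, h2, ⟨hP2, ?_⟩, rfl⟩, _,
          ⟨L₁, h1, ⟨hP1, by omega⟩, rfl⟩, routeLine_append.symm⟩)
        rw [List.countP_append, List.countP_cons_of_pos (p := fun y => decide (y ∈ S)) hx,
          pow_succ] at hLc
        omega
    · rw [Finset.sum_const, smul_eq_mul, pow_succ]
      apply le_of_eq
      ring

lemma IsRoute.eq_of_forall {ι : Type*} {cls : V → ι} {P : V → Prop}
    (hcls : ∀ x y, R x y → P x → P y → cls x = cls y) {x v : V} {L : List V}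
    (h : IsRoute R x L v) (hx : P x) (hL : ∀ y ∈ L, P y) : ∀ y ∈ L, cls y = cls x := by
  induction L generalizing x with
  | nil => simp
  | cons a L ih =>
    have ha : cls x = cls a := hcls x a h.1 hx (hL a (by simp))
    intro y hy
    rcases List.mem_cons.1 hy with rfl | hy
    · exact ha.symm
    · rw [ha]
      exact ih h.2 (hL a (by simp)) (fun y hy => hL y (by simp [hy])) y hy

open Classical in
/-- The number of lines needed for the paths between two vertices with interior in `C`, by
recursion along balanced separators: a bag `S` splits `C` into classes of at most half its size.
Paths that avoid `S` in their interior stay in one class, and the other paths are concatenations of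
at most `w + 2 ≤ 2 ^ q` of these, obtained by `q` doublings. -/
theorem covered_paths [Finite V] {G : SimpleGraph V} (hRG : ∀ u v, R u v → G.Adj u v)
    (D : TreeDecomposition G) {w q : ℕ} (hw : D.width ≤ w) (hq : w + 2 ≤ 2 ^ q) (k : ℕ)
    (C : Finset V) (hC : C.card < 2 ^ k) (u v : V) :
    Covered (routeLines l R (fun L => L.Nodup ∧ ∀ x ∈ L, x ∈ C) u v)
      (routeLines l R (fun _ => True) u v) ((C.card + 1) * (2 * (2 * w + 3) ^ q) ^ k) := by
  have hdirect : ∀ u v, Covered (routeLines l R (fun L => L = []) u v)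
      (routeLines l R (fun _ => True) u v) 1 := fun u v =>
    Covered.of_subsingleton (by
      rintro _ ⟨_, -, rfl, rfl⟩ _ ⟨_, -, rfl, rfl⟩
      rfl) (routeLines_mono (by simp) u v)
  induction k generalizing C u v with
  | zero =>
    have hC0 : C = ∅ := by simpa using hC
    subst hC0
    refine (hdirect u v).mono (routeLines_mono ?_ u v) subset_rfl (by simp)
    rintro L ⟨-, hL⟩
    exact List.eq_nil_iff_forall_not_mem.2 fun x hx => absurd (hL x hx) (by simp)
  | succ k ih =>
    obtain ⟨i, cls, hcls, hbal⟩ := D.exists_separator C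
    set S : Finset V := (Set.toFinite (D.bag i)).toFinset with hS
    have hmemS : ∀ x, x ∈ S ↔ x ∈ D.bag i := fun x => by simp [hS]
    have hScard : S.card ≤ w + 1 := by
      rw [hS, ← Set.ncard_eq_toFinset_card]
      exact TreeDecomposition.ncard_bag_le hw i
    set Q := (2 * (2 * w + 3) ^ q) ^ k with hQ
    have hQpos : 0 < Q := by positivity
    set C' := C.filter (· ∉ D.bag i) with hC'
    let cl : Set D.Node → Finset V := fun c => C.filter fun x => x ∉ D.bag i ∧ cls x = c
    have hsum : ∑ c ∈ C'.image cls, (cl c).card = C'.card := by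
      rw [Finset.card_eq_sum_card_image cls C']
      refine Finset.sum_congr rfl fun c _ => ?_
      rw [hC', Finset.filter_filter]
    have hC'card : C'.card ≤ C.card := Finset.card_filter_le _ _
    have hbase : ∀ u v, Covered
        (routeLines l R (fun L => (L.Nodup ∧ ∀ x ∈ L, x ∈ C) ∧ L.countP (· ∈ S) = 0) u v)
        (routeLines l R (fun _ => True) u v) ((2 * C.card + 1) * Q) := by
      intro u v
      have key := (hdirect u v).union (Covered.biUnion (I := C'.image cls) (fun c _ =>
        ih (cl c) (by
          have := hbal c
          rw [pow_succ] at hC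
          change (C.filter fun x => x ∉ D.bag i ∧ cls x = c).card < 2 ^ k
          omega) u v))
      refine key.mono ?_ subset_rfl ?_
      · rintro _ ⟨L, hL, ⟨⟨hnd, hLC⟩, hLS⟩, rfl⟩
        have hout : ∀ y ∈ L, y ∉ D.bag i := fun y hy hyi => by
          rw [List.countP_eq_zero] at hLS
          exact hLS y hy (by simpa using (hmemS y).2 hyi)
        cases L with
        | nil => exact Or.inl ⟨[], hL, rfl, rfl⟩
        | cons x L =>
          have hxC' : x ∈ C' := by
            simp only [hC', Finset.mem_filter]
            exact ⟨hLC x (by simp), hout x (by simp)⟩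
          refine Or.inr (Set.mem_iUnion₂.2 ⟨cls x, Finset.mem_image_of_mem _ hxC',
            x :: L, hL, ⟨hnd, ?_⟩, rfl⟩)
          have hall := hL.2.eq_of_forall (P := fun y => y ∉ D.bag i)
            (fun a b hab ha hb => hcls a b (hRG a b hab) ha hb) (hout x (by simp))
            (fun y hy => hout y (by simp [hy]))
          intro y hy
          simp only [cl, Finset.mem_filter]
          refine ⟨hLC y hy, hout y hy, ?_⟩
          rcases List.mem_cons.1 hy with rfl | hy
          · rfl
          · exact hall y hy
      · rw [← Finset.sum_mul, Finset.sum_add_distrib, hsum, Finset.sum_const, smul_eq_mul, mul_one]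
        have h1 : (C'.image cls).card ≤ C'.card := Finset.card_image_le
        have h2 : C'.card + (C'.image cls).card ≤ 2 * C.card := by omega
        calc 1 + (C'.card + (C'.image cls).card) * Q ≤ Q + 2 * C.card * Q :=
              Nat.add_le_add hQpos (Nat.mul_le_mul_right _ h2)
          _ = _ := by ring
    have hP : ∀ (L₁ : List V) (x : V) (L₂ : List V),
        ((L₁ ++ x :: L₂).Nodup ∧ ∀ y ∈ L₁ ++ x :: L₂, y ∈ C) →
        (L₁.Nodup ∧ ∀ y ∈ L₁, y ∈ C) ∧ (L₂.Nodup ∧ ∀ y ∈ L₂, y ∈ C) := by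
      rintro L₁ x L₂ ⟨hnd, hL⟩
      rw [List.nodup_append] at hnd
      exact ⟨⟨hnd.1, fun y hy => hL y (by simp [hy])⟩,
        ⟨(List.nodup_cons.1 hnd.2.1).2, fun y hy => hL y (by simp [hy])⟩⟩
    refine (covered_of_countP_lt hP S _ hbase q u v).mono ?_ subset_rfl ?_
    · refine routeLines_mono (fun L hL => ⟨hL, ?_⟩) u v
      have h1 : (L.filter (· ∈ S)).toFinset ⊆ S := by
        intro x hx
        simpa using (List.mem_filter.1 (List.mem_toFinset.1 hx)).2
      have h2 := Finset.card_le_card h1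
      rw [List.toFinset_card_of_nodup (hL.1.filter _), ← List.countP_eq_length_filter] at h2
      exact h2.trans_lt (by omega)
    · calc (2 * S.card + 1) ^ q * ((2 * C.card + 1) * Q)
          ≤ (2 * w + 3) ^ q * ((2 * C.card + 2) * Q) :=
            Nat.mul_le_mul (Nat.pow_le_pow_left (by omega) q) (Nat.mul_le_mul_right _ (by omega))
        _ = (C.card + 1) * (2 * (2 * w + 3) ^ q * Q) := by ring
        _ = _ := by rw [hQ, pow_succ' _ k]

end Routes

end MonoLine

/-! ### Breakpoints and cut points -/

/-- The real function that agrees with `f` at nonnegative real times (with junk values where `f`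
is infinite, and the value `f 0` at negative times). -/
noncomputable def realFun (f : ℝ≥0∞ → ℝ≥0∞) (x : ℝ) : ℝ := (f (ENNReal.ofReal x)).toReal

/-- A finite set of cut points such that `φ` is affine on every interval of nonnegative numbers
without a cut point in its interior. -/
def IsCutSet (φ : ℝ → ℝ) (S : Finset ℝ) : Prop :=
  ∀ a b : ℝ, 0 ≤ a → (∀ x ∈ S, x ∉ Set.Ioo a b) → ∃ m c : ℝ, ∀ t ∈ Set.Ioo a b, φ t = m * t + c

lemma mem_breakpoints {f : ℝ≥0∞ → ℝ≥0∞} {t : ℝ} : t ∈ breakpoints f ↔ 0 < t ∧ ∃ α : ℝ, 0 < α ∧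
    ∀ ε : ℝ, 0 < ε → ε < α → deriv (realFun f) (t - ε) ≠ deriv (realFun f) (t + ε) :=
  Iff.rfl

lemma deriv_eq_of_eqOn_Ioo {φ : ℝ → ℝ} {a b m c t : ℝ} (h : ∀ x ∈ Set.Ioo a b, φ x = m * x + c)
    (ht : t ∈ Set.Ioo a b) : deriv φ t = m := by
  have heq : φ =ᶠ[nhds t] fun x => m * x + c :=
    Filter.eventuallyEq_of_mem (Ioo_mem_nhds ht.1 ht.2) h
  rw [heq.deriv_eq]
  simp

lemma exists_pos_forall_notMem_Ioo (S : Finset ℝ) (t : ℝ) :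
    ∃ δ > 0, ∀ x ∈ S, x ≠ t → x ∉ Set.Ioo (t - δ) (t + δ) := by
  have hopen : IsOpen ((S.erase t : Finset ℝ) : Set ℝ)ᶜ :=
    (S.erase t).finite_toSet.isClosed.isOpen_compl
  obtain ⟨δ, hδ, hsub⟩ := Metric.isOpen_iff.1 hopen t (by simp)
  refine ⟨δ, hδ, fun x hx hne hmem => ?_⟩
  rw [← Real.ball_eq_Ioo] at hmem
  exact hsub hmem (by simp [hx, hne])

lemma breakpoints_subset_of_isCutSet {f : ℝ≥0∞ → ℝ≥0∞} {S : Finset ℝ}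
    (hS : IsCutSet (realFun f) S) : breakpoints f ⊆ S := by
  intro t ht
  obtain ⟨ht0, α, hα, hne⟩ := mem_breakpoints.1 ht
  by_contra htS
  obtain ⟨δ, hδ, hδS⟩ := exists_pos_forall_notMem_Ioo S t
  set r := min δ (min α t) with hr
  have hr0 : 0 < r := by positivity
  have h1 : r ≤ δ := min_le_left _ _
  have h2 : r ≤ α := (min_le_right _ _).trans (min_le_left _ _)
  have h3 : r ≤ t := (min_le_right _ _).trans (min_le_right _ _)
  obtain ⟨m, c, hmc⟩ := hS (t - r) (t + r) (by linarith) (fun x hx hmem =>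
    hδS x hx (fun h => htS (h ▸ hx)) ⟨by linarith [hmem.1], by linarith [hmem.2]⟩)
  refine hne (r / 2) (by linarith) (by linarith) ?_
  rw [deriv_eq_of_eqOn_Ioo hmc ⟨by linarith, by linarith⟩,
    deriv_eq_of_eqOn_Ioo hmc ⟨by linarith, by linarith⟩]

/-- A cut point of a continuous function where the slope does not change can be removed. -/
lemma IsCutSet.erase {f : ℝ≥0∞ → ℝ≥0∞} {S : Finset ℝ} (hS : IsCutSet (realFun f) S)
    (hf : Continuous (realFun f)) {x : ℝ} (hx : x ∉ breakpoints f) :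
    IsCutSet (realFun f) (S.erase x) := by
  intro a b ha hab
  by_cases hxab : x ∈ Set.Ioo a b
  swap
  · refine hS a b ha fun y hy => ?_
    by_cases hyx : y = x
    · rwa [hyx]
    · exact hab y (Finset.mem_erase.2 ⟨hyx, hy⟩)
  obtain ⟨hax, hxb⟩ := hxab
  have havoid : ∀ y ∈ S, y ∈ Set.Ioo a b → y = x := fun y hy hyab => by
    by_contra hyx
    exact hab y (Finset.mem_erase.2 ⟨hyx, hy⟩) hyab
  obtain ⟨m₁, c₁, h₁⟩ := hS a x ha fun y hy hmem =>
    hmem.2.ne (havoid y hy ⟨hmem.1, hmem.2.trans hxb⟩)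
  obtain ⟨m₂, c₂, h₂⟩ := hS x b (ha.trans hax.le) fun y hy hmem =>
    hmem.1.ne' (havoid y hy ⟨hax.trans hmem.1, hmem.2⟩)
  have hm : m₁ = m₂ := by
    by_contra hne
    refine hx (mem_breakpoints.2 ⟨by linarith, min (x - a) (b - x),
      lt_min (by linarith) (by linarith), fun ε hε hε' => ?_⟩)
    have e1 := hε'.trans_le (min_le_left _ _)
    have e2 := hε'.trans_le (min_le_right _ _)
    rwa [deriv_eq_of_eqOn_Ioo h₁ ⟨by linarith, by linarith⟩,
      deriv_eq_of_eqOn_Ioo h₂ ⟨by linarith, by linarith⟩]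
  have hl : realFun f x = m₁ * x + c₁ :=
    Set.EqOn.of_subset_closure (s := Set.Ioo a x) (t := Set.Ioc a x)
      (g := fun y => m₁ * y + c₁) h₁ hf.continuousOn (by fun_prop) Set.Ioo_subset_Ioc_self
      (by rw [closure_Ioo hax.ne]; exact Set.Ioc_subset_Icc_self) ⟨hax, le_rfl⟩
  have hr : realFun f x = m₂ * x + c₂ :=
    Set.EqOn.of_subset_closure (s := Set.Ioo x b) (t := Set.Ico x b)
      (g := fun y => m₂ * y + c₂) h₂ hf.continuousOn (by fun_prop) Set.Ioo_subset_Ico_self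
      (by rw [closure_Ioo hxb.ne]; exact Set.Ico_subset_Icc_self) ⟨le_rfl, hxb⟩
  subst hm
  have hc : c₁ = c₂ := by linarith
  subst hc
  refine ⟨m₁, c₁, fun t ht => ?_⟩
  rcases lt_trichotomy t x with h | h | h
  · exact h₁ t ⟨ht.1, h⟩
  · rw [h, hl]
  · exact h₂ t ⟨h, ht.2⟩

lemma exists_isCutSet_subset_breakpoints {f : ℝ≥0∞ → ℝ≥0∞} {S : Finset ℝ}
    (hS : IsCutSet (realFun f) S) (hf : Continuous (realFun f)) :
    ∃ S' : Finset ℝ, IsCutSet (realFun f) S' ∧ ↑S' ⊆ breakpoints f := by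
  induction hn : S.card generalizing S with
  | zero =>
    rw [Finset.card_eq_zero] at hn
    exact ⟨S, hS, by simp [hn]⟩
  | succ n ih =>
    by_cases hsub : ↑S ⊆ breakpoints f
    · exact ⟨S, hS, hsub⟩
    · obtain ⟨x, hx, hxb⟩ := Set.not_subset.1 hsub
      exact ih (hS.erase hf hxb) (by rw [Finset.card_erase_of_mem hx, hn]; rfl)

namespace IsArrivalFunction

variable {f : ℝ≥0∞ → ℝ≥0∞}

lemma map_top (hf : IsArrivalFunction f) : f ∞ = ∞ := top_le_iff.1 (hf.le_arrival ∞)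

lemma ne_top_of_ne_top (hf : IsArrivalFunction f) {t₀ : ℝ≥0∞} (h₀ : f t₀ ≠ ∞) {t : ℝ≥0∞}
    (ht : t ≠ ∞) : f t ≠ ∞ := by
  rcases hf.piecewiseLinear with h | h
  · exact absurd (h t₀) h₀
  · lift t to ℝ≥0 using ht
    exact h.1 t

lemma continuous_realFun (hf : IsArrivalFunction f) {t₀ : ℝ≥0∞} (h₀ : f t₀ ≠ ∞) :
    Continuous (realFun f) :=
  ENNReal.continuousOn_toReal.comp_continuous (hf.continuous.comp ENNReal.continuous_ofReal)
    fun _ => hf.ne_top_of_ne_top h₀ ENNReal.ofReal_ne_top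

lemma monotone_realFun (hf : IsArrivalFunction f) {t₀ : ℝ≥0∞} (h₀ : f t₀ ≠ ∞) :
    Monotone (realFun f) := fun _ _ h =>
  ENNReal.toReal_mono (hf.ne_top_of_ne_top h₀ ENNReal.ofReal_ne_top)
    (hf.fifo (ENNReal.ofReal_le_ofReal h))

lemma exists_isCutSet (hf : IsArrivalFunction f) {t₀ : ℝ≥0∞} (h₀ : f t₀ ≠ ∞) :
    ∃ S : Finset ℝ, IsCutSet (realFun f) S := by
  rcases hf.piecewiseLinear with h | ⟨-, S, hS⟩
  · exact absurd (h t₀) h₀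
  refine ⟨S.map ⟨NNReal.toReal, NNReal.coe_injective⟩, fun a b ha hab => ?_⟩
  by_cases hlt : a < b
  swap
  · exact ⟨0, 0, fun t ht => absurd (ht.1.trans ht.2) hlt⟩
  lift a to ℝ≥0 using ha
  lift b to ℝ≥0 using a.2.trans hlt.le
  obtain ⟨m, c, hmc⟩ := hS a b fun x hx hmem => hab x (by simpa using hx) (by simpa using hmem)
  refine ⟨m, c, fun t ht => ?_⟩
  lift t to ℝ≥0 using a.2.trans ht.1.le
  have := hmc t (by simpa using ht)
  simpa [realFun] using this

lemma finite_breakpoints (hf : IsArrivalFunction f) {t₀ : ℝ≥0∞} (h₀ : f t₀ ≠ ∞) :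
    (breakpoints f).Finite := by
  obtain ⟨S, hS⟩ := hf.exists_isCutSet h₀
  exact S.finite_toSet.subset (breakpoints_subset_of_isCutSet hS)

/-- An edge arrival function agrees with one line on a set of nonnegative numbers between which
it has no breakpoints. -/
lemma exists_monoLine_eq (hf : IsArrivalFunction f) {t₀ : ℝ≥0∞} (h₀ : f t₀ ≠ ∞) {X : Set ℝ}
    (hX : ∀ x ∈ X, 0 ≤ x)
    (hbp : ∀ x ∈ X, ∀ x' ∈ X, ∀ β ∈ breakpoints f, β ∉ Set.Ioo x x') :
    ∃ ℓ : MonoLine, ∀ x ∈ X, realFun f x = ℓ.eval x := by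
  obtain ⟨S, hS⟩ := hf.exists_isCutSet h₀
  have hcont := hf.continuous_realFun h₀
  have hmono := hf.monotone_realFun h₀
  obtain ⟨S', hS', hsub⟩ := exists_isCutSet_subset_breakpoints hS hcont
  -- the function is affine on the closed interval between two points of `X`
  have hIcc : ∀ a ∈ X, ∀ b ∈ X, a < b →
      ∃ m c : ℝ, ∀ t ∈ Set.Icc a b, realFun f t = m * t + c := by
    intro a ha b hb hab
    obtain ⟨m, c, hmc⟩ := hS' a b (hX a ha) fun x hx => hbp a ha b hb x (hsub hx)
    exact ⟨m, c, Set.EqOn.of_subset_closure (s := Set.Ioo a b) (g := fun y => m * y + c) hmc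
      hcont.continuousOn (by fun_prop) Set.Ioo_subset_Icc_self (closure_Ioo hab.ne).ge⟩
  by_cases hsing : X.Subsingleton
  · rcases hsing.eq_empty_or_singleton with rfl | ⟨x, rfl⟩
    · exact ⟨⟨0, 0, le_rfl⟩, by simp⟩
    · exact ⟨⟨0, realFun f x, le_rfl⟩, by simp [MonoLine.eval]⟩
  obtain ⟨a, ha, b, hb, hab⟩ := (Set.not_subsingleton_iff.1 hsing).exists_lt
  obtain ⟨m, c, hmc⟩ := hIcc a ha b hb hab
  have h1 := hmc a ⟨le_rfl, hab.le⟩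
  have h2 := hmc b ⟨hab.le, le_rfl⟩
  have hm : 0 ≤ m := by
    have := hmono hab.le
    by_contra hneg
    nlinarith
  refine ⟨⟨m, c, hm⟩, fun x hx => ?_⟩
  obtain ⟨m', c', hmc'⟩ := hIcc (min x a) (by rcases min_choice x a with h | h <;> rwa [h])
    (max x b) (by rcases max_choice x b with h | h <;> rwa [h])
    ((min_le_right _ _).trans_lt (hab.trans_le (le_max_right _ _)))
  have h3 := hmc' a ⟨min_le_right _ _, hab.le.trans (le_max_right _ _)⟩
  have h4 := hmc' b ⟨(min_le_right _ _).trans hab.le, le_max_right _ _⟩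
  have hmm : m = m' := by
    have : (m - m') * (b - a) = 0 := by linarith
    rcases mul_eq_zero.1 this with h | h <;> linarith
  subst hmm
  have hcc : c = c' := by linarith
  subst hcc
  exact hmc' x ⟨min_le_left _ _, le_max_left _ _⟩

end IsArrivalFunction

/-! ### Earliest arrivals -/

namespace TimeDependentGraph

variable {V : Type*} (G : TimeDependentGraph V)

@[simp] lemma walkArrival_nil (u : V) (t : ℝ≥0∞) :
    G.walkArrival (.nil : G.graph.Walk u u) t = t := rfl

@[simp] lemma walkArrival_cons {u v w : V} (h : G.graph.Adj u v) (p : G.graph.Walk v w)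
    (t : ℝ≥0∞) : G.walkArrival (.cons h p) t = G.walkArrival p (G.arrival ⟨(u, v), h⟩ t) := rfl

lemma walkArrival_append {u v w : V} (p : G.graph.Walk u v) (q : G.graph.Walk v w) (t : ℝ≥0∞) :
    G.walkArrival (p.append q) t = G.walkArrival q (G.walkArrival p t) := by
  induction p generalizing t with
  | nil => rfl
  | cons h p ih => simp [ih]

lemma le_walkArrival {u v : V} (p : G.graph.Walk u v) (t : ℝ≥0∞) : t ≤ G.walkArrival p t := by
  induction p generalizing t with
  | nil => exact le_rfl
  | cons h p ih => exact ((G.isArrivalFunction _).le_arrival t).trans (ih _)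

lemma walkArrival_mono {u v : V} (p : G.graph.Walk u v) : Monotone (G.walkArrival p) := by
  induction p with
  | nil => exact monotone_id
  | cons h p ih => exact ih.comp (G.isArrivalFunction _).fifo

lemma walkArrival_ne_top {u v : V} (p : G.graph.Walk u v) {t₀ t : ℝ≥0∞}
    (h₀ : G.walkArrival p t₀ ≠ ∞) (ht : t ≠ ∞) : G.walkArrival p t ≠ ∞ := by
  induction p generalizing t₀ t with
  | nil => exact ht
  | cons h p ih =>
    have h1 : G.arrival ⟨(_, _), h⟩ t₀ ≠ ∞ :=
      ((G.le_walkArrival p _).trans_lt (lt_top_iff_ne_top.2 h₀)).ne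
    exact ih h₀ ((G.isArrivalFunction _).ne_top_of_ne_top h1 ht)

open Classical in
/-- Removing the loops of a walk does not delay the arrival, since waiting does not help. -/
lemma walkArrival_bypass_le {u v : V} (p : G.graph.Walk u v) (t : ℝ≥0∞) :
    G.walkArrival p.bypass t ≤ G.walkArrival p t := by
  induction p generalizing t with
  | nil => exact le_rfl
  | @cons u v w h p ih =>
    rw [SimpleGraph.Walk.bypass]
    have h1 : t ≤ G.arrival ⟨(u, v), h⟩ t := (G.isArrivalFunction _).le_arrival t
    by_cases hs : u ∈ p.bypass.support
    · rw [dif_pos hs]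
      have hspec := G.walkArrival_append (p.bypass.takeUntil u hs) (p.bypass.dropUntil u hs)
        (G.arrival ⟨(u, v), h⟩ t)
      rw [SimpleGraph.Walk.take_spec] at hspec
      calc G.walkArrival (p.bypass.dropUntil u hs) t
          ≤ G.walkArrival (p.bypass.dropUntil u hs) (G.walkArrival (p.bypass.takeUntil u hs)
              (G.arrival ⟨(u, v), h⟩ t)) :=
            G.walkArrival_mono _ (h1.trans (G.le_walkArrival _ _))
        _ = G.walkArrival p.bypass (G.arrival ⟨(u, v), h⟩ t) := hspec.symm
        _ ≤ _ := ih _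
    · rw [dif_neg hs]
      exact ih _

lemma endToEnd_le {s v : V} (p : G.graph.Walk s v) (t : ℝ≥0∞) :
    G.endToEnd s v t ≤ G.walkArrival p t := by
  classical
  exact (iInf_le _ p.toPath).trans (G.walkArrival_bypass_le p t)

lemma endToEnd_mono (s v : V) : Monotone (G.endToEnd s v) := fun _ _ h =>
  iInf_mono fun p => G.walkArrival_mono p.1 h

lemma le_endToEnd (s v : V) (t : ℝ≥0∞) : t ≤ G.endToEnd s v t :=
  le_iInf fun p => G.le_walkArrival p.1 t

lemma endToEnd_self (s : V) (t : ℝ≥0∞) : G.endToEnd s s t = t :=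
  le_antisymm (G.endToEnd_le .nil t) (G.le_endToEnd s s t)

lemma exists_path_of_endToEnd_ne_top [Finite V] {s v : V} {t : ℝ≥0∞}
    (h : G.endToEnd s v t ≠ ∞) :
    ∃ p : G.graph.Path s v, G.endToEnd s v t = G.walkArrival p.1 t := by
  classical
  have := Fintype.ofFinite V
  have hne : Nonempty (G.graph.Path s v) := by
    by_contra hno
    rw [not_nonempty_iff] at hno
    exact h (by simp [endToEnd])
  obtain ⟨p, hp⟩ := exists_eq_ciInf_of_finite
    (f := fun p : G.graph.Path s v => G.walkArrival p.1 t)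
  exact ⟨p, hp.symm⟩

lemma endToEnd_ne_top [Finite V] {s v : V} {t₀ t : ℝ≥0∞} (h₀ : G.endToEnd s v t₀ ≠ ∞)
    (ht : t ≠ ∞) : G.endToEnd s v t ≠ ∞ := by
  obtain ⟨p, hp⟩ := G.exists_path_of_endToEnd_ne_top h₀
  exact ((G.endToEnd_le p.1 t).trans_lt
    (lt_top_iff_ne_top.2 (G.walkArrival_ne_top p.1 (hp ▸ h₀) ht))).ne

lemma endToEnd_le_arrival [Finite V] (s : V) {u v : V} (h : G.graph.Adj u v) (t : ℝ≥0∞) :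
    G.endToEnd s v t ≤ G.arrival ⟨(u, v), h⟩ (G.endToEnd s u t) := by
  by_cases htop : G.endToEnd s u t = ∞
  · rw [htop, (G.isArrivalFunction _).map_top]
    exact le_top
  · obtain ⟨p, hp⟩ := G.exists_path_of_endToEnd_ne_top htop
    have := G.endToEnd_le (p.1.append (.cons h .nil)) t
    rwa [walkArrival_append, walkArrival_cons, walkArrival_nil, ← hp] at this

/-- A step from `u` to `v` by which `v` is reached as early as possible from `s`, departing at
time `t`, after reaching `u` as early as possible. -/
def IsTight (s : V) (t : ℝ≥0∞) (e : G.graph.Dart) : Prop :=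
  G.arrival e (G.endToEnd s e.fst t) = G.endToEnd s e.snd t

/-- The first vertex without a path of tight steps on a walk to such a vertex is reached
strictly earlier than the end of the walk. -/
lemma exists_endToEnd_lt [Finite V] {s : V} {t : ℝ≥0∞} {Q : V → Prop}
    (hQ : ∀ e : G.graph.Dart, Q e.fst → G.IsTight s t e → Q e.snd) {u v : V}
    (p : G.graph.Walk u v) {x : ℝ≥0∞} (hu : Q u) (hv : ¬ Q v) (hx : G.endToEnd s u t ≤ x)
    (hfin : G.walkArrival p x ≠ ∞) : ∃ v', ¬ Q v' ∧ G.endToEnd s v' t < G.walkArrival p x := by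
  induction p generalizing x with
  | nil => exact absurd hu hv
  | @cons u u' v h p ih =>
    have h1 := G.endToEnd_le_arrival s h t
    have h2 := (G.isArrivalFunction ⟨(u, u'), h⟩).fifo hx
    by_cases hu' : Q u'
    · exact ih hu' hv (h1.trans h2) hfin
    · refine ⟨u', hu', ?_⟩
      have h3 : G.endToEnd s u' t < G.arrival ⟨(u, u'), h⟩ (G.endToEnd s u t) :=
        lt_of_le_of_ne h1 fun heq => hu' (hQ ⟨(u, u'), h⟩ hu heq.symm)
      exact h3.trans_le (h2.trans (G.le_walkArrival p _))

/-- Every reachable vertex is reached by a path of tight steps: otherwise consider a vertex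
without such a path that is reached earliest. -/
lemma exists_path_forall_isTight [Finite V] {s d : V} {t : ℝ≥0∞} (h : G.endToEnd s d t ≠ ∞) :
    ∃ p : G.graph.Path s d, ∀ e ∈ p.1.darts, G.IsTight s t e := by
  classical
  let Q : V → Prop := fun v => ∃ p : G.graph.Walk s v, ∀ e ∈ p.darts, G.IsTight s t e
  suffices hQd : Q d by
    obtain ⟨p, hp⟩ := hQd
    exact ⟨p.toPath, fun e he => hp e (p.darts_bypass_subset_darts he)⟩
  have hQs : Q s := ⟨.nil, by simp⟩
  have hQ : ∀ e : G.graph.Dart, Q e.fst → G.IsTight s t e → Q e.snd := by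
    rintro e ⟨p, hp⟩ he
    refine ⟨p.append (.cons e.adj .nil), fun e' he' => ?_⟩
    rw [SimpleGraph.Walk.darts_append, List.mem_append] at he'
    rcases he' with he' | he'
    · exact hp e' he'
    · rw [SimpleGraph.Walk.darts_cons, SimpleGraph.Walk.darts_nil, List.mem_singleton] at he'
      rwa [he']
  by_contra hd
  obtain ⟨v, hv, hmin⟩ := (Set.toFinite {v | ¬ Q v}).exists_minimalFor
    (fun v => G.endToEnd s v t) _ ⟨d, hd⟩
  have hmin' : ∀ v', ¬ Q v' → G.endToEnd s v t ≤ G.endToEnd s v' t := fun v' hv' => by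
    by_contra hlt
    exact hlt (hmin hv' (not_le.1 hlt).le)
  have hvfin : G.endToEnd s v t ≠ ∞ := ((hmin' d hd).trans_lt (lt_top_iff_ne_top.2 h)).ne
  obtain ⟨p, hp⟩ := G.exists_path_of_endToEnd_ne_top hvfin
  obtain ⟨v', hv', hlt⟩ := G.exists_endToEnd_lt hQ p.1 (x := t) hQs hv
    (G.endToEnd_self s t).le (hp ▸ hvfin)
  exact absurd (hmin' v' hv') (not_le.2 (hp ▸ hlt))

end TimeDependentGraph

/-! ### Breakpoints of lower envelopes -/

/-- On the set `J`, the function `g` is the minimum of the lines in `F`. -/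
def IsEnvelopeOn (g : ℝ → ℝ) (F : Finset MonoLine) (J : Set ℝ) : Prop :=
  ∀ t ∈ J, (∀ m ∈ F, g t ≤ m.eval t) ∧ ∃ m ∈ F, m.eval t = g t

namespace MonoLine

lemma continuous_eval (ℓ : MonoLine) : Continuous ℓ.eval := by
  unfold eval
  fun_prop

open Classical in
/-- Between the crossing points of finitely many lines, one of them is the lowest. -/
lemma exists_crossings (F : Finset MonoLine) (hF : F.Nonempty) :
    ∃ Q : Finset ℝ, ∀ a b, a < b → (∀ x ∈ Q, x ∉ Set.Ioo a b) →
      ∃ ℓ ∈ F, ∀ x ∈ Set.Ioo a b, ∀ m ∈ F, ℓ.eval x ≤ m.eval x := by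
  refine ⟨(F ×ˢ F).image fun z => (z.2.icpt - z.1.icpt) / (z.1.slope - z.2.slope),
    fun a b hab hQ => ?_⟩
  obtain ⟨x₀, h₀a, h₀b⟩ := exists_between hab
  obtain ⟨ℓ, hℓ, hmin⟩ := F.exists_min_image (fun m => m.eval x₀) hF
  refine ⟨ℓ, hℓ, fun x hx m hm => ?_⟩
  by_contra hlt
  have h1 := hmin m hm
  have hc := hQ _ (Finset.mem_image_of_mem _ (Finset.mk_mem_product hℓ hm))
  simp only [eval] at h1 hlt
  dsimp only at hc
  apply hc
  rcases lt_trichotomy (ℓ.slope - m.slope) 0 with hs | hs | hs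
  · constructor
    · refine hx.1.trans_le ?_
      rw [le_div_iff_of_neg hs]
      linarith
    · refine lt_of_le_of_lt ?_ h₀b
      rw [div_le_iff_of_neg hs]
      linarith
  · rw [sub_eq_zero.1 hs] at h1 hlt
    linarith
  · constructor
    · refine h₀a.trans_le ?_
      rw [le_div_iff₀ hs]
      linarith
    · refine lt_of_le_of_lt ?_ hx.2
      rw [div_le_iff₀ hs]
      linarith

end MonoLine

lemma IsEnvelopeOn.eqOn {g : ℝ → ℝ} {F : Finset MonoLine} {J I : Set ℝ} (h : IsEnvelopeOn g F J)
    (hI : I ⊆ J) {ℓ : MonoLine} (hℓ : ℓ ∈ F) (hmin : ∀ x ∈ I, ∀ m ∈ F, ℓ.eval x ≤ m.eval x) :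
    ∀ x ∈ I, g x = ℓ.eval x := fun x hx => by
  obtain ⟨h1, m, hm, h2⟩ := h x (hI hx)
  exact le_antisymm (h1 ℓ hℓ) ((hmin x hx m hm).trans h2.le)

/-- At a breakpoint of a lower envelope, a steeper line gives way to a flatter one. -/
lemma IsEnvelopeOn.exists_slope_lt {f : ℝ≥0∞ → ℝ≥0∞} {F : Finset MonoLine} {J : Set ℝ}
    (hJ : IsOpen J) (h : IsEnvelopeOn (realFun f) F J) {t : ℝ} (ht : t ∈ J)
    (hbp : t ∈ breakpoints f) : ∃ ℓ₁ ∈ F, ∃ ℓ₂ ∈ F, ℓ₂.slope < ℓ₁.slope ∧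
      ℓ₁.eval t = realFun f t ∧ ℓ₂.eval t = realFun f t := by
  obtain ⟨-, α, hα, hne⟩ := mem_breakpoints.1 hbp
  obtain ⟨-, m₀, hm₀, hm₀t⟩ := h t ht
  obtain ⟨Q, hQ⟩ := MonoLine.exists_crossings F ⟨m₀, hm₀⟩
  obtain ⟨δ, hδ, hδQ⟩ := exists_pos_forall_notMem_Ioo Q t
  obtain ⟨δ', hδ', hsub⟩ := Metric.isOpen_iff.1 hJ t ht
  rw [Real.ball_eq_Ioo] at hsub
  set r := min δ (min δ' α) with hr
  have hr0 : 0 < r := by positivity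
  have h1 : r ≤ δ := min_le_left _ _
  have h2 : r ≤ δ' := (min_le_right _ _).trans (min_le_left _ _)
  have h3 : r ≤ α := (min_le_right _ _).trans (min_le_right _ _)
  obtain ⟨ℓ₁, hℓ₁, hmin₁⟩ := hQ (t - r) t (by linarith) fun x hx hmem =>
    hδQ x hx hmem.2.ne ⟨by linarith [hmem.1], by linarith [hmem.2]⟩
  obtain ⟨ℓ₂, hℓ₂, hmin₂⟩ := hQ t (t + r) (by linarith) fun x hx hmem =>
    hδQ x hx hmem.1.ne' ⟨by linarith [hmem.1], by linarith [hmem.2]⟩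
  have heq₁ := h.eqOn (fun x hx => hsub ⟨by linarith [hx.1], by linarith [hx.2]⟩) hℓ₁ hmin₁
  have heq₂ := h.eqOn (fun x hx => hsub ⟨by linarith [hx.1], by linarith [hx.2]⟩) hℓ₂ hmin₂
  have hval₁ : ∀ m ∈ F, ℓ₁.eval t ≤ m.eval t := fun m hm =>
    le_on_closure (fun x hx => hmin₁ x hx m hm) ℓ₁.continuous_eval.continuousOn
      m.continuous_eval.continuousOn
      (by rw [closure_Ioo (by linarith)]; exact ⟨by linarith, le_rfl⟩)
  have hval₂ : ∀ m ∈ F, ℓ₂.eval t ≤ m.eval t := fun m hm =>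
    le_on_closure (fun x hx => hmin₂ x hx m hm) ℓ₂.continuous_eval.continuousOn
      m.continuous_eval.continuousOn
      (by rw [closure_Ioo (by linarith)]; exact ⟨le_rfl, by linarith⟩)
  have ht₁ : ℓ₁.eval t = realFun f t :=
    le_antisymm ((hval₁ m₀ hm₀).trans hm₀t.le) ((h t ht).1 ℓ₁ hℓ₁)
  have ht₂ : ℓ₂.eval t = realFun f t :=
    le_antisymm ((hval₂ m₀ hm₀).trans hm₀t.le) ((h t ht).1 ℓ₂ hℓ₂)
  refine ⟨ℓ₁, hℓ₁, ℓ₂, hℓ₂, lt_of_le_of_ne ?_ ?_, ht₁, ht₂⟩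
  · have h4 := hmin₁ (t - r / 2) ⟨by linarith, by linarith⟩ ℓ₂ hℓ₂
    have h5 := ht₁.trans ht₂.symm
    simp only [MonoLine.eval] at h4 h5
    nlinarith
  · intro hs
    refine hne (r / 2) (by linarith) (by linarith) ?_
    rw [deriv_eq_of_eqOn_Ioo heq₁ ⟨by linarith, by linarith⟩,
      deriv_eq_of_eqOn_Ioo heq₂ ⟨by linarith, by linarith⟩, hs]

open Classical in
/-- A lower envelope of lines has fewer breakpoints than lines: the line that starts at a
breakpoint determines it, and the steepest line does not start at any. -/
lemma IsEnvelopeOn.ncard_breakpoints_inter_le {f : ℝ≥0∞ → ℝ≥0∞} {F : Finset MonoLine} {J : Set ℝ}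
    (hJ : IsOpen J) (h : IsEnvelopeOn (realFun f) F J) :
    (breakpoints f ∩ J).Finite ∧ (breakpoints f ∩ J).ncard ≤ F.card - 1 := by
  rcases F.eq_empty_or_nonempty with rfl | hF
  · have : breakpoints f ∩ J = ∅ := by
      rw [Set.eq_empty_iff_forall_notMem]
      rintro t ⟨-, ht⟩
      obtain ⟨-, m, hm, -⟩ := h t ht
      simp at hm
    simp [this]
  obtain ⟨ℓ₀, hℓ₀, hmax⟩ := F.exists_max_image MonoLine.slope hF
  have : Nonempty MonoLine := ⟨ℓ₀⟩
  choose! a ha b hb hlt hat hbt using fun t (ht : t ∈ breakpoints f ∩ J) =>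
    h.exists_slope_lt hJ ht.2 ht.1
  have hmaps : Set.MapsTo b (breakpoints f ∩ J) ((F.erase ℓ₀ : Finset MonoLine) : Set MonoLine) := by
    intro t ht
    refine Finset.mem_coe.2 (Finset.mem_erase.2 ⟨fun heq => ?_, hb t ht⟩)
    exact absurd (hlt t ht) (not_lt.2 (heq ▸ hmax _ (ha t ht)))
  have hlt_ne : ∀ t ∈ breakpoints f ∩ J, ∀ t' ∈ breakpoints f ∩ J, t < t' → b t ≠ b t' := by
    intro t ht t' ht' htt heq
    have h1 := (h t ht.2).1 _ (ha t' ht')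
    rw [← hbt t ht, heq] at h1
    have h2 := (hat t' ht').trans (hbt t' ht').symm
    have h3 := hlt t' ht'
    simp only [MonoLine.eval] at h1 h2
    nlinarith
  have hinj : Set.InjOn b (breakpoints f ∩ J) := by
    intro t ht t' ht' heq
    rcases lt_trichotomy t t' with hl | he | hl
    · exact absurd heq (hlt_ne t ht t' ht' hl)
    · exact he
    · exact absurd heq.symm (hlt_ne t' ht' t ht hl)
  refine ⟨Set.Finite.of_injOn hmaps hinj (Finset.finite_toSet _), ?_⟩
  have := Set.ncard_le_ncard_of_injOn b hmaps hinj (Finset.finite_toSet _)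
  rwa [Set.ncard_coe_finset, Finset.card_erase_of_mem hℓ₀] at this

/-- The positive numbers outside of `T` that are greater than exactly `i` elements of `T`. -/
def gap (T : Finset ℝ) (i : ℕ) : Set ℝ := {t | 0 < t ∧ t ∉ T ∧ (T.filter (· < t)).card = i}

lemma mem_gap_of_forall_notMem_Ioo {T : Finset ℝ} {a b t t' : ℝ} (ha : 0 ≤ a)
    (h : ∀ x ∈ T, x ∉ Set.Ioo a b) (ht : t ∈ Set.Ioo a b) (ht' : t' ∈ Set.Ioo a b) :
    t' ∈ gap T (T.filter (· < t)).card := by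
  refine ⟨ha.trans_lt ht'.1, fun hT => h _ hT ht', ?_⟩
  congr 1
  refine Finset.filter_congr fun x hx => ?_
  have := h x hx
  rw [Set.mem_Ioo, not_and_or, not_lt, not_lt] at this
  rcases this with hx | hx
  · exact iff_of_true (hx.trans_lt ht'.1) (hx.trans_lt ht.1)
  · exact iff_of_false (not_lt.2 (ht'.2.le.trans hx)) (not_lt.2 (ht.2.le.trans hx))

lemma isOpen_gap (T : Finset ℝ) (i : ℕ) : IsOpen (gap T i) := by
  rw [Metric.isOpen_iff]
  rintro t ⟨ht0, htT, rfl⟩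
  obtain ⟨δ, hδ, hδT⟩ := exists_pos_forall_notMem_Ioo T t
  refine ⟨min δ t, lt_min hδ ht0, fun t' ht' => ?_⟩
  rw [Real.ball_eq_Ioo] at ht'
  have h1 := min_le_left δ t
  have h2 := min_le_right δ t
  have h3 : 0 < min δ t := lt_min hδ ht0
  refine mem_gap_of_forall_notMem_Ioo (a := t - min δ t) (b := t + min δ t) (by linarith)
    (fun x hx hmem => hδT x hx (fun he => htT (he ▸ hx)) ⟨?_, ?_⟩) ⟨by linarith, by linarith⟩ ht'
  · linarith [hmem.1]
  · linarith [hmem.2]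

/-- Between two numbers in the same gap there is no element of `T`. -/
lemma notMem_Icc_of_mem_gap {T : Finset ℝ} {i : ℕ} {t t' x : ℝ} (ht : t ∈ gap T i)
    (ht' : t' ∈ gap T i) (hx : x ∈ T) : x ∉ Set.Icc t t' := by
  rintro ⟨h1, h2⟩
  have h3 : x < t' := lt_of_le_of_ne h2 fun h => ht'.2.1 (h ▸ hx)
  have hss : T.filter (· < t) ⊂ T.filter (· < t') := by
    refine (Finset.ssubset_iff_of_subset fun y hy => ?_).2 ⟨x, by simp [hx, h3], by simp [h1]⟩
    simp only [Finset.mem_filter] at hy ⊢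
    exact ⟨hy.1, hy.2.trans (h1.trans_lt h3)⟩
  have := Finset.card_lt_card hss
  rw [ht.2.2, ht'.2.2] at this
  exact this.false

section Pieces

variable {f : ℝ≥0∞ → ℝ≥0∞} {T : Finset ℝ} {p : ℕ}

open Classical in
lemma ncard_breakpoints_le_of_gap
    (h : ∀ i, ∃ F : Finset MonoLine, F.card ≤ p ∧ IsEnvelopeOn (realFun f) F (gap T i)) :
    (breakpoints f).Finite ∧ (breakpoints f).ncard ≤ T.card + (T.card + 1) * (p - 1) := by
  choose F hFp hF using h
  have hsub : breakpoints f ⊆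
      ↑T ∪ ⋃ i ∈ Finset.range (T.card + 1), breakpoints f ∩ gap T i := by
    intro t ht
    by_cases htT : t ∈ T
    · exact Or.inl htT
    · refine Or.inr (Set.mem_iUnion₂.2 ⟨(T.filter (· < t)).card, ?_, ht, ht.1, htT, rfl⟩)
      exact Finset.mem_range.2 (Nat.lt_succ_of_le (Finset.card_filter_le _ _))
  have hfin : (↑T ∪ ⋃ i ∈ Finset.range (T.card + 1), breakpoints f ∩ gap T i).Finite :=
    T.finite_toSet.union (Set.Finite.biUnion (Finset.finite_toSet _) fun i _ =>
      ((hF i).ncard_breakpoints_inter_le (isOpen_gap T i)).1)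
  refine ⟨hfin.subset hsub, (Set.ncard_le_ncard hsub hfin).trans
    ((Set.ncard_union_le _ _).trans ?_)⟩
  rw [Set.ncard_coe_finset]
  refine Nat.add_le_add_left ((Finset.set_ncard_biUnion_le _ _).trans ?_) _
  refine (Finset.sum_le_card_nsmul _ _ (p - 1) fun i _ => ?_).trans (by simp)
  exact ((hF i).ncard_breakpoints_inter_le (isOpen_gap T i)).2.trans
    (Nat.sub_le_sub_right (hFp i) 1)

open Classical in
lemma exists_isCutSet_of_gap
    (h : ∀ i, ∃ F : Finset MonoLine, IsEnvelopeOn (realFun f) F (gap T i)) :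
    ∃ S, IsCutSet (realFun f) S := by
  choose F hF using h
  have hQ : ∀ i, ∃ Q : Finset ℝ, (F i).Nonempty → ∀ a b, a < b → (∀ x ∈ Q, x ∉ Set.Ioo a b) →
      ∃ ℓ ∈ F i, ∀ x ∈ Set.Ioo a b, ∀ m ∈ F i, ℓ.eval x ≤ m.eval x := by
    intro i
    by_cases hi : (F i).Nonempty
    · obtain ⟨Q, hQ⟩ := MonoLine.exists_crossings (F i) hi
      exact ⟨Q, fun _ => hQ⟩
    · exact ⟨∅, fun h => absurd h hi⟩
  choose Q hQ using hQ
  refine ⟨T ∪ (Finset.range (T.card + 1)).biUnion Q, fun a b ha hab => ?_⟩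
  by_cases hlt : a < b
  swap
  · exact ⟨0, 0, fun t ht => absurd (ht.1.trans ht.2) hlt⟩
  obtain ⟨t, hta, htb⟩ := exists_between hlt
  have hsub : Set.Ioo a b ⊆ gap T (T.filter (· < t)).card := fun t' ht' =>
    mem_gap_of_forall_notMem_Ioo ha (fun x hx => hab x (Finset.mem_union_left _ hx)) ⟨hta, htb⟩ ht'
  obtain ⟨-, m₀, hm₀, -⟩ := hF _ t (hsub ⟨hta, htb⟩)
  obtain ⟨ℓ, hℓ, hmin⟩ := hQ _ ⟨m₀, hm₀⟩ a b hlt fun x hx =>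
    hab x (Finset.mem_union_right _ (Finset.mem_biUnion.2
      ⟨_, Finset.mem_range.2 (Nat.lt_succ_of_le (Finset.card_filter_le _ _)), hx⟩))
  exact ⟨ℓ.slope, ℓ.icpt, (hF _).eqOn hsub hℓ hmin⟩

lemma isPiecewiseLinear_of_isCutSet (hf : ∀ t, t ≠ ∞ → f t ≠ ∞) {S : Finset ℝ}
    (hS : IsCutSet (realFun f) S) : IsPiecewiseLinear f := by
  refine Or.inr ⟨fun t => hf t ENNReal.coe_ne_top, S.image Real.toNNReal, fun a b hab => ?_⟩
  obtain ⟨m, c, hmc⟩ := hS a b a.2 fun x hx hmem => by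
    refine hab _ (Finset.mem_image_of_mem _ hx) ?_
    lift x to ℝ≥0 using a.2.trans hmem.1.le
    simpa using hmem
  refine ⟨m, c, fun t ht => ?_⟩
  have := hmc t (by simpa using ht)
  simpa [realFun] using this

lemma breakpoints_eq_empty_of_forall_eq_top (hf : ∀ t, f t = ∞) : breakpoints f = ∅ := by
  have h0 : IsCutSet (realFun f) ∅ := fun a b _ _ => ⟨0, 0, fun t _ => by simp [realFun, hf]⟩
  simpa using breakpoints_subset_of_isCutSet h0

end Pieces

/-! ### Replacing edges by lines -/

namespace TimeDependentGraph

open MonoLine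

section Reduction

variable {V : Type*} (G : TimeDependentGraph V) (s : V)

/-- The first departure time from `s` from which on `u` is not reached before the time `β`
(`0` if there is none). -/
noncomputable def departureTime (u : V) (β : ℝ) : ℝ :=
  sInf {t : ℝ | 0 ≤ t ∧ ENNReal.ofReal β ≤ G.endToEnd s u (ENNReal.ofReal t)}

lemma departureTime_mem_Icc {u : V} {β t t' : ℝ} (ht : 0 ≤ t) (htt : t ≤ t')
    (h : G.endToEnd s u (ENNReal.ofReal t) < ENNReal.ofReal β)
    (h' : ENNReal.ofReal β ≤ G.endToEnd s u (ENNReal.ofReal t')) :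
    G.departureTime s u β ∈ Set.Icc t t' := by
  have hmem : t' ∈ {t : ℝ | 0 ≤ t ∧ ENNReal.ofReal β ≤ G.endToEnd s u (ENNReal.ofReal t)} :=
    ⟨ht.trans htt, h'⟩
  refine ⟨le_csInf ⟨t', hmem⟩ fun x hx => ?_, csInf_le ⟨0, fun x hx => hx.1⟩ hmem⟩
  by_contra hlt
  exact absurd (hx.2.trans (G.endToEnd_mono s u (ENNReal.ofReal_le_ofReal (not_le.1 hlt).le)))
    (not_le.2 h)

lemma finite_breakpoints_arrival (e : G.graph.Dart) : (breakpoints (G.arrival e)).Finite := by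
  by_cases h : ∀ t, G.arrival e t = ∞
  · rw [breakpoints_eq_empty_of_forall_eq_top h]
    exact Set.finite_empty
  · push Not at h
    obtain ⟨t₀, h₀⟩ := h
    exact (G.isArrivalFunction e).finite_breakpoints h₀

open Classical in
/-- The departure times from `s` at which the tail of some edge is reached at a breakpoint of the
edge. -/
noncomputable def criticalTimes [Fintype V] : Finset ℝ :=
  Finset.univ.biUnion fun e : G.graph.Dart =>
    (G.finite_breakpoints_arrival e).toFinset.image (G.departureTime s e.fst)

open Classical in
lemma card_criticalTimes_le [Fintype V] :
    (G.criticalTimes s).card ≤ ∑ e : G.graph.Dart, (breakpoints (G.arrival e)).ncard := by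
  refine Finset.card_biUnion_le.trans (Finset.sum_le_sum fun e _ => ?_)
  rw [Set.ncard_eq_toFinset_card _ (G.finite_breakpoints_arrival e)]
  exact Finset.card_image_le

/-- A direction of an edge that can be traversed and whose tail is reachable from `s`. -/
def IsUsable (u v : V) : Prop :=
  ∃ h : G.graph.Adj u v, (∃ t₀, G.arrival ⟨(u, v), h⟩ t₀ ≠ ∞) ∧ G.endToEnd s u 0 ≠ ∞

variable {G s} [Fintype V]

/-- As long as the departure time from `s` does not cross a critical time, an edge can be replaced
by a line, for those who reach its tail as early as possible. -/
lemma IsUsable.exists_monoLine {u v : V} (huv : G.IsUsable s u v) (i : ℕ) :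
    ∃ ℓ : MonoLine, ∀ t ∈ gap (G.criticalTimes s) i, ∀ h : G.graph.Adj u v,
      (G.arrival ⟨(u, v), h⟩ (G.endToEnd s u (ENNReal.ofReal t))).toReal =
        ℓ.eval (G.endToEnd s u (ENNReal.ofReal t)).toReal := by
  classical
  obtain ⟨h, ⟨t₀, h₀⟩, hu⟩ := huv
  have hfin : ∀ t, G.endToEnd s u (ENNReal.ofReal t) ≠ ∞ := fun t =>
    G.endToEnd_ne_top hu ENNReal.ofReal_ne_top
  obtain ⟨ℓ, hℓ⟩ := (G.isArrivalFunction ⟨(u, v), h⟩).exists_monoLine_eq h₀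
    (X := (fun t => (G.endToEnd s u (ENNReal.ofReal t)).toReal) '' gap (G.criticalTimes s) i)
    (by
      rintro _ ⟨t, -, rfl⟩
      exact ENNReal.toReal_nonneg)
    (by
      rintro _ ⟨t, ht, rfl⟩ _ ⟨t', ht', rfl⟩ β hβ ⟨hβ1, hβ2⟩
      have h1 : G.endToEnd s u (ENNReal.ofReal t) < ENNReal.ofReal β :=
        (ENNReal.lt_ofReal_iff_toReal_lt (hfin t)).2 hβ1
      have h2 : ENNReal.ofReal β ≤ G.endToEnd s u (ENNReal.ofReal t') :=
        (ENNReal.ofReal_le_iff_le_toReal (hfin t')).2 hβ2.le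
      have htt : t ≤ t' := by
        by_contra hlt
        exact absurd (h2.trans (G.endToEnd_mono s u
          (ENNReal.ofReal_le_ofReal (not_le.1 hlt).le))) (not_le.2 h1)
      refine notMem_Icc_of_mem_gap ht ht' ?_ (G.departureTime_mem_Icc s ht.1.le htt h1 h2)
      exact Finset.mem_biUnion.2 ⟨⟨(u, v), h⟩, Finset.mem_univ _,
        Finset.mem_image_of_mem _ (by simpa using hβ)⟩)
  refine ⟨ℓ, fun t ht _ => ?_⟩
  rw [← hℓ _ ⟨t, ht, rfl⟩, realFun, ENNReal.ofReal_toReal (hfin t)]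

variable {l : V → V → MonoLine} {t : ℝ}

/-- Replacing the edges by lines does not allow to reach a vertex earlier. -/
lemma endToEnd_le_routeLine
    (hl : ∀ u v, G.IsUsable s u v → ∀ h : G.graph.Adj u v,
      (G.arrival ⟨(u, v), h⟩ (G.endToEnd s u (ENNReal.ofReal t))).toReal =
        (l u v).eval (G.endToEnd s u (ENNReal.ofReal t)).toReal)
    {u v : V} {L : List V} (hL : IsRoute (G.IsUsable s) u L v) {x : ℝ}
    (hx : (G.endToEnd s u (ENNReal.ofReal t)).toReal ≤ x) :
    (G.endToEnd s v (ENNReal.ofReal t)).toReal ≤ (routeLine l u L v).eval x := by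
  have hstep : ∀ u v, G.IsUsable s u v → ∀ x, (G.endToEnd s u (ENNReal.ofReal t)).toReal ≤ x →
      (G.endToEnd s v (ENNReal.ofReal t)).toReal ≤ (l u v).eval x := by
    intro u v huv x hx
    obtain ⟨h, ⟨t₀, h₀⟩, hu⟩ := id huv
    calc (G.endToEnd s v (ENNReal.ofReal t)).toReal
        ≤ (G.arrival ⟨(u, v), h⟩ (G.endToEnd s u (ENNReal.ofReal t))).toReal :=
          ENNReal.toReal_mono ((G.isArrivalFunction _).ne_top_of_ne_top h₀
            (G.endToEnd_ne_top hu ENNReal.ofReal_ne_top)) (G.endToEnd_le_arrival s h _)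
      _ = (l u v).eval (G.endToEnd s u (ENNReal.ofReal t)).toReal := hl u v huv h
      _ ≤ _ := (l u v).eval_mono hx
  induction L generalizing u x with
  | nil => exact hstep u v hL x hx
  | cons a L ih =>
    rw [routeLine, eval_comp]
    exact ih hL.2 (hstep u a hL.1 x hx)

/-- A walk of tight steps is a route whose line attains the earliest arrival. -/
lemma exists_route_of_forall_isTight
    (hl : ∀ u v, G.IsUsable s u v → ∀ h : G.graph.Adj u v,
      (G.arrival ⟨(u, v), h⟩ (G.endToEnd s u (ENNReal.ofReal t))).toReal =
        (l u v).eval (G.endToEnd s u (ENNReal.ofReal t)).toReal)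
    {u v : V} (p : G.graph.Walk u v) (hp : ∀ e ∈ p.darts, G.IsTight s (ENNReal.ofReal t) e)
    (hfin : G.endToEnd s v (ENNReal.ofReal t) ≠ ∞) (hnil : ¬ p.Nil) :
    ∃ L, p.support = u :: (L ++ [v]) ∧ IsRoute (G.IsUsable s) u L v ∧
      (routeLine l u L v).eval (G.endToEnd s u (ENNReal.ofReal t)).toReal =
        (G.endToEnd s v (ENNReal.ofReal t)).toReal := by
  have hstep : ∀ u v, ∀ h : G.graph.Adj u v, G.IsTight s (ENNReal.ofReal t) ⟨(u, v), h⟩ →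
      G.endToEnd s v (ENNReal.ofReal t) ≠ ∞ → G.IsUsable s u v ∧
      (l u v).eval (G.endToEnd s u (ENNReal.ofReal t)).toReal =
        (G.endToEnd s v (ENNReal.ofReal t)).toReal := by
    intro u v h ht hv
    have ht' : G.arrival ⟨(u, v), h⟩ (G.endToEnd s u (ENNReal.ofReal t)) =
      G.endToEnd s v (ENNReal.ofReal t) := ht
    have hu : G.endToEnd s u (ENNReal.ofReal t) ≠ ∞ :=
      (((G.isArrivalFunction ⟨(u, v), h⟩).le_arrival _).trans_lt
        (lt_top_iff_ne_top.2 (ht'.symm ▸ hv))).ne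
    have huse : G.IsUsable s u v :=
      ⟨h, ⟨_, ht'.symm ▸ hv⟩, G.endToEnd_ne_top hu ENNReal.zero_ne_top⟩
    exact ⟨huse, by rw [← hl u v huse h, ht']⟩
  induction p with
  | nil => exact absurd .nil hnil
  | @cons u a v h p ih =>
    have htight := hp ⟨(u, a), h⟩ (by simp)
    cases p with
    | nil =>
      obtain ⟨h1, h2⟩ := hstep u a h htight hfin
      exact ⟨[], rfl, h1, h2⟩
    | cons h' p' =>
      obtain ⟨L, hL1, hL2, hL3⟩ := ih (fun e he => hp e (by
        rw [SimpleGraph.Walk.darts_cons]; exact List.mem_cons_of_mem _ he)) hfin (by simp)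
      have ha : G.endToEnd s a (ENNReal.ofReal t) ≠ ∞ :=
        G.endToEnd_ne_top (t₀ := 0) (by
          cases L with
          | nil => exact hL2.2.2
          | cons b L => exact hL2.1.2.2) ENNReal.ofReal_ne_top
      obtain ⟨h1, h2⟩ := hstep u a h htight ha
      refine ⟨a :: L, ?_, ⟨h1, hL2⟩, ?_⟩
      · rw [SimpleGraph.Walk.support_cons, hL1]
        rfl
      · rw [routeLine, eval_comp, h2, hL3]

/-- Between critical times, the earliest arrival is the lower envelope of the lines of a set of
routes that covers the paths. -/
lemma exists_isEnvelopeOn_gap {d : V} (hsd : s ≠ d) (hd : G.endToEnd s d 0 ≠ ∞) {p : ℕ}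
    (hcov : ∀ l : V → V → MonoLine, Covered
      (routeLines l (G.IsUsable s) (fun L => (s :: (L ++ [d])).Nodup) s d)
      (routeLines l (G.IsUsable s) (fun _ => True) s d) p) (i : ℕ) :
    ∃ F : Finset MonoLine, F.card ≤ p ∧
      IsEnvelopeOn (realFun (G.endToEnd s d)) F (gap (G.criticalTimes s) i) := by
  have hex : ∀ u v, ∃ ℓ : MonoLine, G.IsUsable s u v → ∀ t ∈ gap (G.criticalTimes s) i,
      ∀ h : G.graph.Adj u v,
      (G.arrival ⟨(u, v), h⟩ (G.endToEnd s u (ENNReal.ofReal t))).toReal =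
        ℓ.eval (G.endToEnd s u (ENNReal.ofReal t)).toReal := by
    intro u v
    by_cases huv : G.IsUsable s u v
    · obtain ⟨ℓ, hℓ⟩ := huv.exists_monoLine i
      exact ⟨ℓ, fun _ => hℓ⟩
    · exact ⟨⟨0, 0, le_rfl⟩, fun h => absurd h huv⟩
  choose l hl using hex
  obtain ⟨F, hFsub, hFcard, hF⟩ := hcov l
  refine ⟨F, hFcard, fun t ht => ?_⟩
  have hl' := fun u v huv h => hl u v huv t ht h
  have hs : (G.endToEnd s s (ENNReal.ofReal t)).toReal = t := by
    rw [endToEnd_self, ENNReal.toReal_ofReal ht.1.le]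
  have hlow : ∀ m ∈ F, realFun (G.endToEnd s d) t ≤ m.eval t := by
    intro m hm
    obtain ⟨L, hL, -, rfl⟩ := hFsub hm
    exact endToEnd_le_routeLine hl' hL hs.le
  refine ⟨hlow, ?_⟩
  have hdt : G.endToEnd s d (ENNReal.ofReal t) ≠ ∞ := G.endToEnd_ne_top hd ENNReal.ofReal_ne_top
  obtain ⟨⟨q, hq⟩, htight⟩ := G.exists_path_forall_isTight hdt
  obtain ⟨L, hL1, hL2, hL3⟩ := exists_route_of_forall_isTight hl' q htight hdt
    (fun h => hsd h.eq)
  rw [hs] at hL3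
  obtain ⟨m, hm, hle⟩ := hF _ ⟨L, hL2,
    show (s :: (L ++ [d])).Nodup from hL1 ▸ hq.support_nodup, rfl⟩ t
  exact ⟨m, hm, le_antisymm (hle.trans hL3.le) (hlow m hm)⟩

open Classical in
lemma sum_ncard_breakpoints_lt_totalPieces {d : V} (hsd : s ≠ d) (hd : G.endToEnd s d 0 ≠ ∞) :
    ∑ e : G.graph.Dart, (breakpoints (G.arrival e)).ncard < G.totalPieces := by
  obtain ⟨⟨q, hq⟩, hqd⟩ := G.exists_path_of_endToEnd_ne_top hd
  rw [hqd] at hd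
  have hle : ∀ e, (breakpoints (G.arrival e)).ncard ≤ numPieces (G.arrival e) := by
    intro e
    unfold numPieces
    split_ifs with h
    · rw [breakpoints_eq_empty_of_forall_eq_top h, Set.ncard_empty]
    · exact Nat.le_succ _
  cases q with
  | nil => exact absurd rfl hsd
  | @cons _ a _ h q =>
    refine Finset.sum_lt_sum (fun e _ => hle e) ⟨⟨(s, a), h⟩, Finset.mem_univ _, ?_⟩
    have hne : ¬ ∀ t, G.arrival ⟨(s, a), h⟩ t = ∞ := fun hall => hd (by
      rw [walkArrival_cons, hall]
      exact top_le_iff.1 (G.le_walkArrival q ∞))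
    unfold numPieces
    rw [if_neg hne]
    exact Nat.lt_succ_self _

/-- If the paths from `s` to `d` are covered by `p` lines whenever the edges carry single lines,
then every linear piece of an edge contributes at most `p` linear pieces to the end-to-end arrival
function. -/
theorem breakpoints_endToEnd_le {d : V} {K p : ℕ} (hp : 0 < p) (hK : G.totalPieces ≤ K)
    (hcov : ∀ l : V → V → MonoLine, Covered
      (routeLines l (G.IsUsable s) (fun L => (s :: (L ++ [d])).Nodup) s d)
      (routeLines l (G.IsUsable s) (fun _ => True) s d) p) :
    IsPiecewiseLinear (G.endToEnd s d) ∧ (breakpoints (G.endToEnd s d)).Finite ∧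
      (breakpoints (G.endToEnd s d)).ncard ≤ K * p := by
  by_cases hd : G.endToEnd s d 0 = ∞
  · have hall : ∀ t, G.endToEnd s d t = ∞ := fun t => by
      by_contra ht
      exact G.endToEnd_ne_top ht ENNReal.zero_ne_top hd
    rw [breakpoints_eq_empty_of_forall_eq_top hall]
    exact ⟨Or.inl hall, Set.finite_empty, by simp⟩
  have hfin : ∀ t, t ≠ ∞ → G.endToEnd s d t ≠ ∞ := fun t ht => G.endToEnd_ne_top hd ht
  rcases eq_or_ne s d with rfl | hsd
  · have hcut : IsCutSet (realFun (G.endToEnd s s)) ∅ := fun a b ha _ => ⟨1, 0, fun t ht => by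
      rw [realFun, endToEnd_self, ENNReal.toReal_ofReal (ha.trans ht.1.le)]
      ring⟩
    have hempty : breakpoints (G.endToEnd s s) = ∅ := by
      simpa using breakpoints_subset_of_isCutSet hcut
    rw [hempty]
    exact ⟨isPiecewiseLinear_of_isCutSet hfin hcut, Set.finite_empty, by simp⟩
  have henv := exists_isEnvelopeOn_gap hsd hd hcov
  obtain ⟨S, hS⟩ := exists_isCutSet_of_gap fun i => (henv i).imp fun _ h => h.2
  obtain ⟨h1, h2⟩ := ncard_breakpoints_le_of_gap henv
  refine ⟨isPiecewiseLinear_of_isCutSet hfin hS, h1, h2.trans ?_⟩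
  have h3 := G.card_criticalTimes_le s
  have h4 := sum_ncard_breakpoints_lt_totalPieces hsd hd
  have h5 : (G.criticalTimes s).card + 1 ≤ K := by omega
  calc (G.criticalTimes s).card + ((G.criticalTimes s).card + 1) * (p - 1)
      ≤ K * 1 + K * (p - 1) := Nat.add_le_add (by omega) (Nat.mul_le_mul_right _ h5)
    _ = K * p := by rw [← Nat.mul_add]; congr 1; omega

end Reduction

end TimeDependentGraph

/-! ### The bound -/

lemma exists_treeDecomposition_width_le {V : Type*} {G : SimpleGraph V} {w : ℕ}
    (h : treewidth G ≤ w) : ∃ D : TreeDecomposition G, D.width ≤ w := by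
  have hne : {k : ℕ | ∃ D : TreeDecomposition G, D.width = k}.Nonempty :=
    ⟨_, { Node := Unit
          tree := ⊥
          isTree := SimpleGraph.IsTree.of_subsingleton
          bag := fun _ => Set.univ
          cover := fun _ => ⟨(), trivial⟩
          edge_cover := fun _ _ _ => ⟨(), trivial, trivial⟩
          path_inter := fun _ _ _ _ _ => Set.subset_univ _ }, rfl⟩
  obtain ⟨D, hD⟩ := Nat.sInf_mem hne
  exact ⟨D, hD.le.trans h⟩

namespace MonoLine

variable {V : Type*} {G : SimpleGraph V} {R : V → V → Prop} {l : V → V → MonoLine}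

lemma IsRoute.exists_walk (hRG : ∀ u v, R u v → G.Adj u v) {u v : V} {L : List V}
    (h : IsRoute R u L v) : ∃ p : G.Walk u v, p.support = u :: (L ++ [v]) := by
  induction L generalizing u with
  | nil => exact ⟨.cons (hRG _ _ h) .nil, rfl⟩
  | cons x L ih =>
    obtain ⟨p, hp⟩ := ih h.2
    exact ⟨.cons (hRG _ _ h.1) p, by rw [SimpleGraph.Walk.support_cons, hp]; rfl⟩

/-- In a forest, there is at most one path between two vertices. -/
lemma covered_paths_of_isAcyclic (hG : G.IsAcyclic) (hRG : ∀ u v, R u v → G.Adj u v) (u v : V) :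
    Covered (routeLines l R (fun L => (u :: (L ++ [v])).Nodup) u v)
      (routeLines l R (fun _ => True) u v) 1 := by
  refine Covered.of_subsingleton ?_ (routeLines_mono (fun _ _ => trivial) u v)
  rintro _ ⟨L, hL, hnd, rfl⟩ _ ⟨L', hL', hnd', rfl⟩
  obtain ⟨p, hp⟩ := hL.exists_walk hRG
  obtain ⟨p', hp'⟩ := hL'.exists_walk hRG
  have h := (hG.subsingleton_path u v).elim
    ⟨p, (SimpleGraph.Walk.isPath_def p).2 (hp ▸ hnd)⟩
    ⟨p', (SimpleGraph.Walk.isPath_def p').2 (hp' ▸ hnd')⟩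
  have hpp : p.support = p'.support := congrArg (fun r : G.Path u v => r.1.support) h
  rw [hp, hp'] at hpp
  have hLL : L = L' := by simpa using hpp
  rw [hLL]

end MonoLine

/-- The numerical bound `(n + 1) * (2 * (2 * w + 3) ^ q) ^ k ≤ n ^ O((log w) ^ 2)` for `k ≈ log₂ n`
and `q ≈ log₂ w`. -/
lemma mul_pow_pow_le_rpow {n w k q : ℕ} (hn : 2 ≤ n) (hw : 2 ≤ w) (hk : k = Nat.log 2 n + 1)
    (hq : q = Nat.log 2 (w + 2) + 1) :
    (((n + 1) * (2 * (2 * w + 3) ^ q) ^ k : ℕ) : ℝ) ≤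
      (n : ℝ) ^ (22 / (Real.log 2) ^ 2 * (Real.log w) ^ 2) := by
  have hnR : (2 : ℝ) ≤ n := by exact_mod_cast hn
  have hwR : (2 : ℝ) ≤ w := by exact_mod_cast hw
  set a := Real.log 2 with ha
  set W := Real.log w with hW
  set N := Real.log n with hN
  have ha0 : 0 < a := Real.log_pos (by norm_num)
  have haW : a ≤ W := Real.log_le_log (by norm_num) hwR
  have haN : a ≤ N := Real.log_le_log (by norm_num) hnR
  have hka : k * a ≤ 2 * N := by
    have h1 : (2 : ℝ) ^ Nat.log 2 n ≤ n := by exact_mod_cast Nat.pow_log_le_self 2 (by omega)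
    have h2 := Real.log_le_log (by positivity) h1
    rw [Real.log_pow] at h2
    rw [hk]
    push_cast
    linarith
  have hqa : q * a ≤ 3 * W := by
    have h1 : (2 : ℝ) ^ Nat.log 2 (w + 2) ≤ (w + 2 : ℕ) := by
      exact_mod_cast Nat.pow_log_le_self 2 (by omega)
    have h2 := Real.log_le_log (by positivity) (h1.trans (show ((w + 2 : ℕ) : ℝ) ≤ 2 * w by
      push_cast; linarith))
    rw [Real.log_pow, Real.log_mul (by norm_num) (by positivity)] at h2
    rw [hq]
    push_cast
    linarith
  have hw4 : Real.log (2 * w + 3) ≤ 3 * W := by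
    have h1 : (2 * w + 3 : ℝ) ≤ 2 * (2 * w) := by linarith
    have h2 := Real.log_le_log (by positivity) h1
    rw [Real.log_mul (by norm_num) (by positivity),
      Real.log_mul (by norm_num) (by positivity)] at h2
    linarith
  have hn1 : Real.log (n + 1) ≤ 2 * N := by
    have h1 : (n + 1 : ℝ) ≤ n * n := by nlinarith
    have h2 := Real.log_le_log (by positivity) h1
    rw [Real.log_mul (by positivity) (by positivity)] at h2
    linarith
  rw [Real.rpow_def_of_pos (by positivity)]
  push_cast
  rw [← Real.log_le_iff_le_exp (by positivity), Real.log_mul (by positivity) (by positivity),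
    Real.log_pow, Real.log_mul (by norm_num) (by positivity), Real.log_pow]
  -- `log (n + 1)` contributes `2 * N` and the power contributes `20 * N * (W / a) ^ 2`.
  have hW0 : 0 < W := ha0.trans_le haW
  have hN0 : 0 < N := ha0.trans_le haN
  have haa : a ^ 2 ≤ W ^ 2 := pow_le_pow_left₀ ha0.le haW 2
  have h1 : a * (a + q * Real.log (2 * w + 3)) ≤ 10 * W ^ 2 := by
    have : (q * a) * Real.log (2 * w + 3) ≤ (3 * W) * (3 * W) :=
      mul_le_mul hqa hw4 (Real.log_nonneg (by linarith)) (by positivity)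
    nlinarith
  have h2 : (k * a) * (a * (a + q * Real.log (2 * w + 3))) ≤ (2 * N) * (10 * W ^ 2) :=
    mul_le_mul hka h1
      (mul_nonneg ha0.le (add_nonneg ha0.le (mul_nonneg (Nat.cast_nonneg _)
        (Real.log_nonneg (by linarith))))) (by positivity)
  have h3 : a ^ 2 * Real.log (n + 1) ≤ W ^ 2 * (2 * N) :=
    mul_le_mul haa hn1 (Real.log_nonneg (by linarith)) (by positivity)
  have h4 : N * (22 / a ^ 2 * W ^ 2) = (22 * N * W ^ 2) / a ^ 2 := by ring
  rw [h4, le_div_iff₀ (by positivity)]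
  linarith

theorem theorem3 :
    ∃ C : ℝ, 0 < C ∧
      ∀ (V : Type*) [Fintype V] (G : TimeDependentGraph V) (n w K : ℕ),
        Fintype.card V ≤ n → treewidth G.graph ≤ w → G.totalPieces ≤ K →
        ∀ s d : V,
          IsPiecewiseLinear (G.endToEnd s d) ∧
          (breakpoints (G.endToEnd s d)).Finite ∧
          ((breakpoints (G.endToEnd s d)).ncard : ℝ) ≤
            (K : ℝ) * (n : ℝ) ^ (C * (Real.log w) ^ 2) := by
  have hlog : 0 < Real.log 2 := Real.log_pos (by norm_num)
  refine ⟨22 / (Real.log 2) ^ 2, by positivity, fun V _ G n w K hn hw hK s d => ?_⟩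
  have hn1 : 1 ≤ n := (Fintype.card_pos_iff.2 ⟨s⟩).trans_le hn
  obtain ⟨D, hD⟩ := exists_treeDecomposition_width_le hw
  have hRG : ∀ u v, G.IsUsable s u v → G.graph.Adj u v := fun _ _ h => h.1
  -- For a forest, and for a single vertex, one line suffices.
  have hforest : G.graph.IsAcyclic → IsPiecewiseLinear (G.endToEnd s d) ∧
      (breakpoints (G.endToEnd s d)).Finite ∧ ((breakpoints (G.endToEnd s d)).ncard : ℝ) ≤
        (K : ℝ) * (n : ℝ) ^ (22 / (Real.log 2) ^ 2 * (Real.log w) ^ 2) := by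
    intro hG
    obtain ⟨h1, h2, h3⟩ := TimeDependentGraph.breakpoints_endToEnd_le one_pos hK fun l =>
      MonoLine.covered_paths_of_isAcyclic (l := l) hG hRG s d
    refine ⟨h1, h2, (Nat.cast_le.2 h3).trans ?_⟩
    rw [mul_one]
    exact le_mul_of_one_le_right (Nat.cast_nonneg _)
      (Real.one_le_rpow (by exact_mod_cast hn1) (by positivity))
  rcases Nat.lt_or_ge w 2 with hw2 | hw2
  · exact hforest (D.isAcyclic_of_width_le_one (by omega))
  rcases Nat.lt_or_ge n 2 with hn2 | hn2
  · have : Subsingleton V := Fintype.card_le_one_iff_subsingleton.1 (by omega)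
    exact hforest SimpleGraph.IsAcyclic.of_subsingleton
  obtain ⟨h1, h2, h3⟩ := TimeDependentGraph.breakpoints_endToEnd_le
    (p := (n + 1) * (2 * (2 * w + 3) ^ (Nat.log 2 (w + 2) + 1)) ^ (Nat.log 2 n + 1))
    (by positivity) hK fun l =>
      (MonoLine.covered_paths (l := l) hRG D hD (Nat.lt_pow_succ_log_self one_lt_two (w + 2)).le
        (Nat.log 2 n + 1) Finset.univ
        (hn.trans_lt (Nat.lt_pow_succ_log_self one_lt_two n)) s d).mono
        (MonoLine.routeLines_mono (fun L hL => ⟨(List.nodup_append.1 (List.nodup_cons.1 hL).2).1,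
          fun x _ => Finset.mem_univ x⟩) s d) subset_rfl
        (Nat.mul_le_mul_right _ (Nat.add_le_add_right hn 1))
  refine ⟨h1, h2, (Nat.cast_le.2 h3).trans ?_⟩
  rw [Nat.cast_mul]
  exact mul_le_mul_of_nonneg_left (mul_pow_pow_le_rpow hn2 hw2 rfl rfl) (Nat.cast_nonneg _)
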